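/- Consider a $K$-user MIMO interference channel with $N_t$ transmit and $N_r$ receive antennas and $d$ data streams per user, with transmit beamforming matrices $V_i=[v_i^{(1)},\dots,v_i^{(d)}]$ and receive filters $U_k=[u_k^{(1)},\dots,u_k^{(d)}]$ (all columns of unit norm, fixed given the available channel matrices $\hat H_{ki}$), noise variance $\sigma^2>0$, and positive semidefinite antenna correlation matrices $\Sigma_t,\Sigma_r$. Fix a receiver $k$, a stream $m$ and a target rate $R>0$, and let $\Upsilon_k\subseteq\{1,\dots,K\}$ with $k\in\Upsilon_k$ be the set of transmitters whose channels to receiver $k$ are known perfectly. The true channels are $\hat H_{ki}+E_{ki}$, where $E_{ki}=0$ for $i\in\Upsilon_k$ and, for $i\notin\Upsilon_k$, $E_{ki}=\Sigma_r^{1/2}H_{ki}^{(w)}\Sigma_t^{1/2}$, all entries of all these $H^{(w)}_{ki}$ being i.i.d. circularly-symmetric complex Gaussian $\mathcal{CN}(0,\sigma_h^2)$. Let $$\mathsf{SINR}=\frac{|u_k^{(m)H}\hat H_{kk}v_k^{(m)}|^2}{|u_k^{(m)H}E_{kk}v_k^{(m)}|^2+\sum_{j\ne m}|u_k^{(m)H}(\hat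 H_{kk}+E_{kk})v_k^{(j)}|^2+\sum_{i\ne k}\sum_{j=1}^d|u_k^{(m)H}(\hat H_{ki}+E_{ki})v_i^{(j)}|^2+\sigma^2},$$ $$\tau'=\frac{|u_k^{(m)H}\hat H_{kk}v_k^{(m)}|^2}{2^{R}-1}-\sum_{i\in\Upsilon_k}\sum_{j\ne m}|u_k^{(m)H}\hat H_{ki}v_i^{(j)}|^2-\sum_{i\in\Upsilon_k,\,i\ne k}|u_k^{(m)H}\hat H_{ki}v_i^{(m)}|^2-\sigma^2 .$$ Let $X$ be the random vector with the $(K-|\Upsilon_k|)d$ entries $u_k^{(m)H}(\hat H_{ki}+E_{ki})v_i^{(j)}$, $i\notin\Upsilon_k$, $1\le j\le d$; let $\mu=\mathbb E X$ and let $\Sigma=\mathbb E[(X-\mu)(X-\mu)^H]$, assumed positive definite. Let $\Sigma=\Psi\Lambda\Psi^H$ be any unitary eigendecomposition, with distinct eigenvalues $\lambda_1,\dots,\lambda_{\kappa'}$ of multiplicities $\kappa_1,\dots,\kappa_{\kappa'}$, let $\chi_i^{(j)}$ be the entry of $\Lambda^{-1/2}\Psi^H\mu$ corresponding to the $j$-th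 eigenvector of $\lambda_i$, and put $\|\chi_i\|^2=\sum_{j=1}^{\kappa_i}|\chi_i^{(j)}|^2$ and $$g_{1,i}(s)=\frac{e^{\tau's}}{s-1/\lambda_i}\cdot\frac{\exp\Big(-\sum_{p\ne i}\frac{(s-1/\lambda_i)\lambda_p}{1+(s-1/\lambda_i)\lambda_p}\|\chi_p\|^2\Big)}{\prod_{p\ne i}\big(1+(s-1/\lambda_i)\lambda_p\big)^{\kappa_p}} .$$ Then $\sum_{i=1}^{\kappa'}\kappa_i=(K-|\Upsilon_k|)d$. If $\tau'>0$, or if $\tau'=0$ and $\Upsilon_k\neq\{1,\dots,K\}$, then $$\Pr\{\log_2(1+\mathsf{SINR})\le R\}=-\sum_{i=1}^{\kappa'}\frac{e^{-(\tau'/\lambda_i+\|\chi_i\|^2)}}{\lambda_i^{\kappa_i}}\sum_{n=\kappa_i-1}^{\infty}\frac{1}{n!}\,g_{1,i}^{(n)}(0)\,\frac{1}{(n-\kappa_i+1)!}\Big(\frac{\|\chi_i\|^2}{\lambda_i}\Big)^{n-\kappa_i+1},$$ where the inner series converge absolutely. If $\tau'\le 0$, the outage probability is $1$. -/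

import Mathlib

open scoped Matrix NNReal ComplexOrder MatrixOrder
open MeasureTheory ProbabilityTheory

noncomputable section

/-- The circularly-symmetric complex Gaussian law `CN(0, v)` on `ℂ`: real and imaginary parts are
independent, each distributed as `N(0, v / 2)`. -/
def complexGaussian (v : ℝ≥0) : Measure ℂ :=
  ((gaussianReal 0 (v / 2)).prod (gaussianReal 0 (v / 2))).map
    (fun p : ℝ × ℝ => (⟨p.1, p.2⟩ : ℂ))

/-- Deterministic data of a `K`-user MIMO interference channel with `Nt` transmit and `Nr` receive
antennas and `d` streams per user: everything that is fixed once the available channel state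
information is given. -/
structure MIMOSystem (K d Nt Nr : ℕ) where
  /-- `Hhat k i` is the available channel matrix from transmitter `i` to receiver `k`. -/
  Hhat : Fin K → Fin K → Matrix (Fin Nr) (Fin Nt) ℂ
  /-- Transmit antenna correlation matrix. -/
  Sigma_t : Matrix (Fin Nt) (Fin Nt) ℂ
  /-- Receive antenna correlation matrix. -/
  Sigma_r : Matrix (Fin Nr) (Fin Nr) ℂ
  /-- Variance of the entries of the white matrices in the error model. -/
  sigma_h_sq : ℝ≥0
  /-- Variance of the thermal noise. -/
  noise : ℝ
  /-- Transmit beamforming matrices; column `j` of `V i` is the beam of stream `j` of user `i`. -/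
  V : Fin K → Matrix (Fin Nt) (Fin d) ℂ
  /-- Receive filters; column `m` of `U k` is the filter for stream `m` of user `k`. -/
  U : Fin K → Matrix (Fin Nr) (Fin d) ℂ
  posSemidef_t : Sigma_t.PosSemidef
  posSemidef_r : Sigma_r.PosSemidef
  noise_pos : 0 < noise
  norm_V : ∀ i j, ∑ a, ‖V i a j‖ ^ 2 = 1
  norm_U : ∀ k m, ∑ a, ‖U k a m‖ ^ 2 = 1

namespace MIMOSystem

variable {K d Nt Nr : ℕ} (S : MIMOSystem K d Nt Nr) {Ω : Type*}

/-- The scalar `u_k^{(m)H} A v_i^{(j)}`: the effective gain, through the matrix `A`, of stream `j`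
of user `i` after the receive filter of stream `m` of user `k`. -/
def gain (k : Fin K) (m : Fin d) (i : Fin K) (j : Fin d)
    (A : Matrix (Fin Nr) (Fin Nt) ℂ) : ℂ :=
  ((S.U k)ᴴ * A * S.V i) m j

/-- The channel estimation errors `E_{ki}` at a receiver that knows exactly the channels from the
transmitters in `Υ`: zero for `i ∈ Υ`, and `Σ_r^{1/2} H_i^{(w)} Σ_t^{1/2}` otherwise. -/
def csiError (Υ : Finset (Fin K)) (Hw : Fin K → Ω → Matrix (Fin Nr) (Fin Nt) ℂ)
    (i : Fin K) (ω : Ω) : Matrix (Fin Nr) (Fin Nt) ℂ :=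
  if i ∈ Υ then 0 else CFC.sqrt S.Sigma_r * Hw i ω * CFC.sqrt S.Sigma_t

/-- The SINR of stream `m` of user `k`, when the errors at receiver `k` are `E i = E_{ki}`. -/
def sinr (k : Fin K) (m : Fin d) (E : Fin K → Matrix (Fin Nr) (Fin Nt) ℂ) : ℝ :=
  ‖S.gain k m k m (S.Hhat k k)‖ ^ 2 /
    (‖S.gain k m k m (E k)‖ ^ 2
      + ∑ j ∈ Finset.univ.erase m, ‖S.gain k m k j (S.Hhat k k + E k)‖ ^ 2
      + ∑ i ∈ Finset.univ.erase k, ∑ j, ‖S.gain k m i j (S.Hhat k i + E i)‖ ^ 2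
      + S.noise)

/-- The outage event of stream `m` of user `k` for the target rate `R`: the rate supported by the
SINR does not exceed `R`. -/
def outage (k : Fin K) (m : Fin d) (R : ℝ) (Υ : Finset (Fin K))
    (Hw : Fin K → Ω → Matrix (Fin Nr) (Fin Nt) ℂ) : Set Ω :=
  {ω | Real.logb 2 (1 + S.sinr k m (fun i => S.csiError Υ Hw i ω)) ≤ R}

/-- The threshold `τ'`: what remains of the tolerated interference after subtracting the known
interference and the noise. -/
def threshold (k : Fin K) (m : Fin d) (R : ℝ) (Υ : Finset (Fin K)) : ℝ :=
  ‖S.gain k m k m (S.Hhat k k)‖ ^ 2 / ((2 : ℝ) ^ R - 1)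
    - ∑ i ∈ Υ, ∑ j ∈ Finset.univ.erase m, ‖S.gain k m i j (S.Hhat k i)‖ ^ 2
    - ∑ i ∈ Υ.erase k, ‖S.gain k m i m (S.Hhat k i)‖ ^ 2
    - S.noise

/-- The random vector of the effective gains of all streams coming over the links outside `Υ`;
it has `(K - |Υ|) d` entries. -/
def interference (k : Fin K) (m : Fin d) (Υ : Finset (Fin K))
    (Hw : Fin K → Ω → Matrix (Fin Nr) (Fin Nt) ℂ) (ω : Ω) (p : {i // i ∉ Υ} × Fin d) : ℂ :=
  if p.1.1 = k ∧ p.2 = m then S.gain k m k m (S.csiError Υ Hw k ω)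
  else S.gain k m p.1 p.2 (S.Hhat k p.1 + S.csiError Υ Hw p.1 ω)

end MIMOSystem

/-- Mean of a complex random vector, entrywise. -/
def meanVec {n Ω : Type*} [MeasurableSpace Ω] (P : Measure Ω) (X : Ω → n → ℂ) : n → ℂ :=
  fun p => ∫ ω, X ω p ∂P

/-- Covariance matrix `E[(X - E X) (X - E X)ᴴ]` of a complex random vector. -/
def covMat {n Ω : Type*} [MeasurableSpace Ω] (P : Measure Ω) (X : Ω → n → ℂ) : Matrix n n ℂ :=
  Matrix.of fun p q => ∫ ω, (X ω p - meanVec P X p) * star (X ω q - meanVec P X q) ∂P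

/-- A unitary eigendecomposition `A = Ψ Λ Ψᴴ` with the eigenvectors grouped by distinct
eigenvalues: `eig 0, …, eig (num - 1)` are the distinct eigenvalues, `eig i` has multiplicity
`mult i`, and the column `⟨i, j⟩` of `Ψ` is its `j`-th eigenvector. -/
structure EigenDecomposition {n : Type*} [Fintype n] [DecidableEq n] (A : Matrix n n ℂ) where
  num : ℕ
  eig : Fin num → ℝ
  mult : Fin num → ℕ
  Psi : Matrix n (Σ i, Fin (mult i)) ℂ
  eig_injective : Function.Injective eig
  mult_pos : ∀ i, 0 < mult i
  conjTranspose_mul : Psiᴴ * Psi = 1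
  mul_conjTranspose : Psi * Psiᴴ = 1
  decomposition : A = Psi *
    (Matrix.diagonal (fun p => (eig p.1 : ℂ)) :
      Matrix (Σ i, Fin (mult i)) (Σ i, Fin (mult i)) ℂ) * Psiᴴ

namespace EigenDecomposition

variable {n : Type*} [Fintype n] [DecidableEq n] {A : Matrix n n ℂ} (D : EigenDecomposition A)

/-- The entry `χ_i^{(j)}` of `Λ^{-1/2} Ψᴴ μ`. -/
def chi (μ : n → ℂ) (i : Fin D.num) (j : Fin (D.mult i)) : ℂ :=
  ((Real.sqrt (D.eig i))⁻¹ : ℂ) * (D.Psiᴴ *ᵥ μ) ⟨i, j⟩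

/-- `∑_j |χ_i^{(j)}|²`. -/
def chiSq (μ : n → ℂ) (i : Fin D.num) : ℝ := ∑ j, ‖D.chi μ i j‖ ^ 2

/-- The function `g_{1,i}`, with threshold `τ`. -/
def g (μ : n → ℂ) (τ : ℝ) (i : Fin D.num) (s : ℂ) : ℂ :=
  Complex.exp (τ * s) / (s - 1 / D.eig i) *
    (Complex.exp (-∑ p ∈ Finset.univ.erase i,
        (s - 1 / D.eig i) * D.eig p / (1 + (s - 1 / D.eig i) * D.eig p) * D.chiSq μ p) /
      ∏ p ∈ Finset.univ.erase i, (1 + (s - 1 / D.eig i) * D.eig p) ^ D.mult p)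

/-- The term of index `l ≥ mult i - 1` of the inner series belonging to `eig i`. -/
def seriesTerm (μ : n → ℂ) (τ : ℝ) (i : Fin D.num) (l : ℕ) : ℂ :=
  1 / (l.factorial : ℂ) * iteratedDeriv l (D.g μ τ i) 0 *
    (1 / ((l + 1 - D.mult i).factorial : ℂ)) *
    ((D.chiSq μ i / D.eig i : ℝ) : ℂ) ^ (l + 1 - D.mult i)

end EigenDecomposition

end

/-! Since `k ∈ Υ`, clearing denominators in the SINR shows that outage means `‖X‖² ≥ τ'`
(`outage_eq`), so the probability sought is a tail of `‖X‖²`. Here `X = μ + A h` with `h` i.i.d.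
circular Gaussian, and whitening by `Λ^{-1/2} Ψᴴ` turns `‖X‖²` into `∑ λ_i |w_{ij} + χ_i^{(j)}|²`
with `w` standard (`map_mulVec_pi_complexGaussian`, `sum_norm_sq_eq`). Its Laplace transform `F` is
an explicit product, holomorphic off the points `-1/λ_i < 0` and vanishing at infinity as soon as
there is an eigenvalue.

The tail is recovered without a Bromwich integral, which need not converge absolutely. By
Liouville's theorem `F` is the sum of its principal parts, each a Cauchy integral of `F` over a
small circle (`eq_sum_circleIntegral_of_tendsto_zero`). Writing `1/(z - s) = ∫_0^∞ e^{-(z-s)x} dx`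
there exhibits `F` on the imaginary axis as the Fourier transform of `f(x) = ∑ (2πi)⁻¹ ∮ e^{xs} F(s)
ds` on `x > 0`, so by uniqueness of characteristic functions `f` is the density. Integrating it over
`x > a` gives minus the sum of the residues of `e^{as} F(s) / s` at the points `-1/λ_i`.

These points may be essential singularities. With `w = s + 1/λ_i` the integrand is a constant times
`g_{1,i}(w) w^{-κ_i} exp(‖χ_i‖² / (λ_i w))`; expanding the last exponential and applying Cauchy's
formula for the Taylor coefficients of `g_{1,i}` yields the inner series
(`hasSum_residue_mul_exp_div`). -/

/-! ### Cauchy integrals over circles and partial fractions. -/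

open Filter Topology Metric in
/-- The Cauchy integral of a continuous density on a circle is holomorphic off the circle. -/
theorem differentiableAt_circleIntegral_inv_sub_mul {F : ℂ → ℂ} {p z : ℂ} {r : ℝ} (hr : 0 ≤ r)
    (hF : ContinuousOn F (sphere p r)) (hz : z ∉ sphere p r) :
    DifferentiableAt ℂ (fun z => ∮ s in C(p, r), (z - s)⁻¹ * F s) z := by
  -- A ball of twice the radius is kept clear of the circle, so that all points of `ball z δ` stay
  -- at distance at least `δ` from it; this bounds the differentiated integrand uniformly.
  obtain ⟨δ, hδ, hball⟩ : ∃ δ > 0, ball z (2 * δ) ⊆ (sphere p r)ᶜ := by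
    obtain ⟨δ, hδ, h⟩ := Metric.isOpen_iff.1 isClosed_sphere.isOpen_compl z hz
    exact ⟨δ / 2, by positivity, by simpa [mul_div_cancel₀] using h⟩
  have hsep : ∀ x ∈ ball z δ, ∀ s ∈ sphere p r, δ ≤ ‖x - s‖ := by
    intro x hx s hs
    by_contra! hlt
    refine hball (a := s) ?_ hs
    rw [mem_ball] at hx ⊢
    have h1 : dist s x < δ := by rwa [dist_comm, dist_eq_norm]
    linarith [dist_triangle s x z]
  have hmem : ∀ θ, circleMap p r θ ∈ sphere p r := fun θ => circleMap_mem_sphere p hr θ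
  have hFc : Continuous fun θ => F (circleMap p r θ) :=
    hF.comp_continuous (continuous_circleMap p r) hmem
  have hdc : Continuous (deriv (circleMap p r)) := by
    have : deriv (circleMap p r) = fun θ => circleMap 0 r θ * Complex.I := by
      ext θ; simp
    rw [this]; fun_prop
  obtain ⟨B, hB⟩ := (isCompact_sphere p r).exists_bound_of_continuousOn hF
  have hne : ∀ x ∈ ball z δ, ∀ θ, x - circleMap p r θ ≠ 0 := fun x hx θ =>
    norm_pos_iff.1 (hδ.trans_le (hsep x hx _ (hmem θ)))
  have hcont : ∀ x ∈ ball z δ, Continuous fun θ =>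
      deriv (circleMap p r) θ • ((x - circleMap p r θ)⁻¹ * F (circleMap p r θ)) := fun x hx =>
    hdc.smul (((continuous_const.sub (continuous_circleMap p r)).inv₀ (hne x hx)).mul hFc)
  have hzb : z ∈ ball z δ := mem_ball_self hδ
  have key := intervalIntegral.hasDerivAt_integral_of_dominated_loc_of_deriv_le
    (μ := volume) (a := 0) (b := 2 * Real.pi) (𝕜 := ℂ)
    (F := fun x θ => deriv (circleMap p r) θ • ((x - circleMap p r θ)⁻¹ * F (circleMap p r θ)))
    (F' := fun x θ => deriv (circleMap p r) θ •
      ((-1 / (x - circleMap p r θ) ^ 2) * F (circleMap p r θ)))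
    (bound := fun _ => r * ((1 / δ ^ 2) * B))
    (ball_mem_nhds z hδ)
    (Filter.mem_of_superset (ball_mem_nhds z hδ) fun x hx => (hcont x hx).aestronglyMeasurable)
    ((hcont z hzb).intervalIntegrable _ _)
    (hdc.smul ((continuous_const.div ((continuous_const.sub (continuous_circleMap p r)).pow 2)
      (fun θ => pow_ne_zero 2 (hne z hzb θ))).mul hFc)).aestronglyMeasurable
    (ae_of_all _ fun θ _ x hx => by
      have h1 := hsep x hx _ (hmem θ)
      have h2 := hB _ (hmem θ)
      rw [norm_smul, norm_mul, norm_div, norm_pow]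
      have h3 : ‖deriv (circleMap p r) θ‖ = r := by simp [abs_of_nonneg hr]
      rw [h3, norm_neg, norm_one]
      gcongr)
    intervalIntegrable_const
    (ae_of_all _ fun θ _ x hx => by
      have h : HasDerivAt (fun x : ℂ => (x - circleMap p r θ)⁻¹)
          (-1 / (x - circleMap p r θ) ^ 2) x :=
        ((hasDerivAt_id x).sub_const (circleMap p r θ)).fun_inv (hne x hx θ)
      exact HasDerivAt.fun_const_smul (deriv (circleMap p r) θ) (h.mul_const (F (circleMap p r θ))))
  exact key.2.differentiableAt

open Filter Topology Metric in
/-- The Cauchy integral of a continuous density on a circle vanishes at infinity. -/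
theorem tendsto_circleIntegral_inv_sub_mul_cocompact {F : ℂ → ℂ} {p : ℂ} {r : ℝ} (hr : 0 ≤ r)
    (hF : ContinuousOn F (sphere p r)) :
    Tendsto (fun z => ∮ s in C(p, r), (z - s)⁻¹ * F s) (cocompact ℂ) (𝓝 0) := by
  obtain ⟨B, hB⟩ := (isCompact_sphere p r).exists_bound_of_continuousOn hF
  have hd : Tendsto (fun z : ℂ => dist z p - r) (cocompact ℂ) atTop :=
    tendsto_atTop_add_const_right _ _ (tendsto_dist_right_cocompact_atTop p)
  have hlim : Tendsto (fun z : ℂ => 2 * Real.pi * r * ((dist z p - r)⁻¹ * B))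
      (cocompact ℂ) (𝓝 0) := by
    simpa using ((tendsto_inv_atTop_zero.comp hd).mul_const B).const_mul (2 * Real.pi * r)
  refine squeeze_zero_norm' ?_ hlim
  filter_upwards [hd.eventually_gt_atTop 0] with z hz
  refine circleIntegral.norm_integral_le_of_norm_le_const hr fun s hs => ?_
  rw [norm_mul, norm_inv]
  have h1 : dist z p - r ≤ ‖z - s‖ := by
    have := dist_triangle z s p
    rw [mem_sphere] at hs
    rw [← dist_eq_norm]; linarith
  gcongr
  exact hB s hs

open Filter Topology Metric in
/-- Cauchy's integral formula in an annulus. -/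
theorem eq_circleIntegral_add_circleIntegral_of_annulus {F : ℂ → ℂ} {p z : ℂ} {r R : ℝ}
    (hr : 0 < r) (hF : ∀ s, s ≠ p → dist s p ≤ R → DifferentiableAt ℂ F s)
    (hz : r < dist z p) (hzR : dist z p < R) :
    F z = -((2 * Real.pi * Complex.I)⁻¹ * ∮ s in C(p, R), (z - s)⁻¹ * F s) +
      (2 * Real.pi * Complex.I)⁻¹ * ∮ s in C(p, r), (z - s)⁻¹ * F s := by
  have hrR : r < R := hz.trans hzR
  have hzp : z ≠ p := by rintro rfl; simp at hz; linarith
  have hFc : ∀ ρ, 0 < ρ → ρ ≤ R → ContinuousOn F (sphere p ρ) := fun ρ h0 h1 s hs => by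
    rw [mem_sphere] at hs
    exact (hF s (by rintro rfl; simp at hs; linarith) (hs.trans_le h1)).continuousAt.continuousWithinAt
  -- The slope `(F s - F z) / (s - z)` has a removable singularity at `z`, so Cauchy's theorem on
  -- the annulus equates its integrals over the two circles. Only the outer circle winds around `z`,
  -- which isolates `F z`.
  have hann : (∮ s in C(p, R), dslope F z s) = ∮ s in C(p, r), dslope F z s := by
    refine Complex.circleIntegral_eq_of_differentiable_on_annulus_off_countable hr hrR.le
      (Set.countable_singleton z) ?_ ?_
    · intro s hs
      have hsp : s ≠ p := by rintro rfl; exact hs.2 (mem_ball_self hr)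
      have hd := hF s hsp (mem_closedBall.1 hs.1)
      refine ContinuousAt.continuousWithinAt ?_
      by_cases h : s = z
      · subst h; exact continuousAt_dslope_same.2 hd
      · exact (continuousAt_dslope_of_ne h).2 hd.continuousAt
    · intro s hs
      have hsp : s ≠ p := by rintro rfl; exact hs.1.2 (mem_closedBall_self hr.le)
      exact (differentiableAt_dslope_of_ne hs.2).2
        (hF s hsp (mem_ball.1 hs.1.1).le)
  have hsplit : ∀ ρ, 0 < ρ → ρ ≤ R → ρ ≠ dist z p → (∮ s in C(p, ρ), dslope F z s) =
      -(∮ s in C(p, ρ), (z - s)⁻¹ * F s) - F z * ∮ s in C(p, ρ), (s - z)⁻¹ := by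
    intro ρ h0 h1 h2
    have hne : ∀ s ∈ sphere p ρ, s - z ≠ 0 := by
      intro s hs h
      rw [sub_eq_zero] at h; subst h; exact h2 (mem_sphere.1 hs).symm
    have hne' : ∀ s ∈ sphere p ρ, z - s ≠ 0 := fun s hs h => hne s hs (by rw [← neg_sub, h, neg_zero])
    have i1 : CircleIntegrable (fun s => -((z - s)⁻¹ * F s)) p ρ :=
      (((continuousOn_const.sub continuousOn_id).inv₀ hne').mul (hFc ρ h0 h1)).neg.circleIntegrable h0.le
    have i2 : CircleIntegrable (fun s => F z * (s - z)⁻¹) p ρ :=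
      (continuousOn_const.mul ((continuousOn_id.sub continuousOn_const).inv₀ hne)).circleIntegrable h0.le
    have e1 : (∮ s in C(p, ρ), -((z - s)⁻¹ * F s)) = -∮ s in C(p, ρ), (z - s)⁻¹ * F s := by
      simpa using circleIntegral.integral_const_mul (-1) (fun s => (z - s)⁻¹ * F s) p ρ
    rw [← circleIntegral.integral_const_mul, ← e1, ← circleIntegral.integral_sub i1 i2]
    refine circleIntegral.integral_congr h0.le fun s hs => ?_
    have := hne s hs
    have := hne' s hs
    rw [dslope_of_ne _ (sub_ne_zero.1 (hne s hs)), slope_def_field, ← neg_sub s z]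
    field_simp
  rw [hsplit R (hr.trans hrR) le_rfl hzR.ne', hsplit r hr hrR.le hz.ne,
    circleIntegral.integral_sub_inv_of_mem_ball (mem_ball.2 hzR)] at hann
  have h0 : (∮ s in C(p, r), (s - z)⁻¹) = 0 := by
    refine DiffContOnCl.circleIntegral_eq_zero hr.le (DifferentiableOn.diffContOnCl fun s hs => ?_)
    have hs' := closure_ball_subset_closedBall hs
    refine ((differentiableAt_id.sub_const z).inv fun h => ?_).differentiableWithinAt
    rw [id, sub_eq_zero] at h; subst h
    exact absurd (mem_closedBall.1 hs') (not_le.2 hz)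
  rw [h0] at hann
  have := Complex.two_pi_I_ne_zero
  rw [mul_zero, sub_zero] at hann
  have e : F z = (2 * Real.pi * Complex.I)⁻¹ * (F z * (2 * Real.pi * Complex.I)) := by
    field_simp
  rw [e, ← mul_neg, ← mul_add]
  congr 1
  linear_combination -hann

open Filter Topology Metric in
/-- **Partial fractions.** A function holomorphic off a finite set and vanishing at infinity is
the sum of its principal parts. -/
theorem eq_sum_circleIntegral_of_tendsto_zero (A : Finset ℂ) {r : ℝ} (hr : 0 < r) {F : ℂ → ℂ}
    (hF : ∀ s ∉ A, DifferentiableAt ℂ F s) (hlim : Tendsto F (cocompact ℂ) (𝓝 0))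
    (hsep : ∀ p ∈ A, ∀ q ∈ A, p ≠ q → 2 * r < dist p q) {z : ℂ} (hz : ∀ p ∈ A, r < dist z p) :
    F z = ∑ p ∈ A, (2 * Real.pi * Complex.I)⁻¹ * ∮ s in C(p, r), (z - s)⁻¹ * F s := by
  induction A using Finset.induction_on generalizing F with
  | empty =>
    simpa using Differentiable.apply_eq_of_tendsto_cocompact (fun s => hF s (by simp)) z hlim
  | insert p A hp ih =>
    have hcirc : ContinuousOn F (sphere p r) := by
      intro s hs
      rw [mem_sphere] at hs
      refine (hF s ?_).continuousAt.continuousWithinAt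
      rw [Finset.mem_insert, not_or]
      refine ⟨by rintro rfl; simp at hs; linarith, fun hsA => ?_⟩
      have := hsep s (Finset.mem_insert_of_mem hsA) p (Finset.mem_insert_self _ _)
        (by rintro rfl; exact hp hsA)
      linarith
    set T : ℂ → ℂ := fun z => (2 * Real.pi * Complex.I)⁻¹ * ∮ s in C(p, r), (z - s)⁻¹ * F s with hT
    have hTd : ∀ z, z ∉ sphere p r → DifferentiableAt ℂ T z := fun z hz =>
      (differentiableAt_circleIntegral_inv_sub_mul hr.le hcirc hz).const_mul _
    have hsub : ∀ s, s ≠ p → dist s p ≤ 2 * r → s ∉ insert p A := by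
      intro s h1 h2
      rw [Finset.mem_insert, not_or]
      refine ⟨h1, fun hsA => ?_⟩
      linarith [hsep s (Finset.mem_insert_of_mem hsA) p (Finset.mem_insert_self _ _) h1]
    have hcirc2 : ContinuousOn F (sphere p (2 * r)) := by
      intro s hs
      rw [mem_sphere] at hs
      refine (hF s (hsub s ?_ hs.le)).continuousAt.continuousWithinAt
      rintro rfl; simp at hs; linarith
    -- On the annulus between radii `r` and `2 * r` one has `F = Q + T`, with `Q` holomorphic in the
    -- whole larger disc. Gluing `Q` to `F - T` thus removes the singularity at `p`, and the
    -- induction hypothesis applies to the result `E`.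
    set Q : ℂ → ℂ := fun z =>
      -((2 * Real.pi * Complex.I)⁻¹ * ∮ s in C(p, 2 * r), (z - s)⁻¹ * F s) with hQ
    have hQd : ∀ z, z ∈ ball p (2 * r) → DifferentiableAt ℂ Q z := fun z hz =>
      ((differentiableAt_circleIntegral_inv_sub_mul (by positivity) hcirc2 (fun h => by
        rw [mem_ball] at hz; rw [mem_sphere] at h; linarith)).const_mul _).neg
    have hFQ : ∀ z, r < dist z p → dist z p < 2 * r → F z = Q z + T z := fun z h1 h2 =>
      eq_circleIntegral_add_circleIntegral_of_annulus hr
        (fun s hs hs2 => hF s (hsub s hs hs2)) h1 h2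
    classical
    set E : ℂ → ℂ := fun z => if dist z p < 2 * r then Q z else F z - T z with hE
    have hEout : ∀ z, r < dist z p → E z = F z - T z := by
      intro z hz
      by_cases h : dist z p < 2 * r
      · simp only [hE, h, if_true]; rw [hFQ z hz h]; ring
      · simp only [hE, h, if_false]
    have hEd : ∀ s ∉ A, DifferentiableAt ℂ E s := by
      intro s hs
      by_cases h : dist s p < 2 * r
      · refine (hQd s h).congr_of_eventuallyEq ?_
        filter_upwards [isOpen_ball.mem_nhds (mem_ball.2 h)] with x hx
        simp only [hE, mem_ball.1 hx, if_true]
      · have hr' : r < dist s p := by linarith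
        have hTs := hTd s (fun h' => by rw [mem_sphere] at h'; linarith)
        have hFs := hF s (by
          rw [Finset.mem_insert, not_or]
          exact ⟨by rintro rfl; simp at hr'; linarith, hs⟩)
        refine (hFs.sub hTs).congr_of_eventuallyEq ?_
        have ho : IsOpen {x : ℂ | r < dist x p} :=
          isOpen_lt continuous_const (continuous_id.dist continuous_const)
        filter_upwards [ho.mem_nhds hr'] with x hx
        exact hEout x hx
    have hTlim : Tendsto T (cocompact ℂ) (𝓝 0) := by
      have h := (tendsto_circleIntegral_inv_sub_mul_cocompact hr.le hcirc).const_mul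
        (2 * Real.pi * Complex.I)⁻¹
      rwa [mul_zero] at h
    have hElim : Tendsto E (cocompact ℂ) (𝓝 0) := by
      have h := hlim.sub hTlim
      rw [sub_zero] at h
      refine h.congr' ?_
      filter_upwards [(tendsto_dist_right_cocompact_atTop p).eventually_gt_atTop r] with x hx
      exact (hEout x hx).symm
    have hzp := hz p (Finset.mem_insert_self _ _)
    have key := ih hEd hElim
      (fun a ha b hb => hsep a (Finset.mem_insert_of_mem ha) b (Finset.mem_insert_of_mem hb))
      (fun a ha => hz a (Finset.mem_insert_of_mem ha))
    rw [hEout z hzp] at key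
    rw [Finset.sum_insert hp, ← sub_eq_iff_eq_add', key]
    refine Finset.sum_congr rfl fun q hq => ?_
    congr 1
    have hpq := hsep q (Finset.mem_insert_of_mem hq) p (Finset.mem_insert_self _ _)
      (by rintro rfl; exact hp hq)
    have hzq := hz q (Finset.mem_insert_of_mem hq)
    have hfar : ∀ s ∈ closedBall q r, r < dist s p := by
      intro s hs
      rw [mem_closedBall, dist_comm] at hs
      linarith [dist_triangle q s p]
    have hne : ∀ s ∈ closedBall q r, z - s ≠ 0 := by
      intro s hs h
      rw [sub_eq_zero] at h; subst h
      rw [mem_closedBall] at hs; linarith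
    have hTq : ∀ s ∈ closedBall q r, DifferentiableAt ℂ (fun s => (z - s)⁻¹ * T s) s := by
      intro s hs
      refine ((differentiableAt_id.const_sub z).inv (hne s hs)).mul (hTd s fun h => ?_)
      rw [mem_sphere] at h; linarith [hfar s hs]
    have hFq : ContinuousOn (fun s => (z - s)⁻¹ * F s) (sphere q r) := by
      intro s hs
      have hs' := sphere_subset_closedBall hs
      refine (((continuousAt_const.sub continuousAt_id).inv₀ (hne s hs')).mul
        (hF s ?_).continuousAt).continuousWithinAt
      rw [Finset.mem_insert, not_or]
      refine ⟨by rintro rfl; have := hfar _ hs'; simp at this; linarith, fun hsA => ?_⟩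
      rw [mem_sphere] at hs
      have := hsep s (Finset.mem_insert_of_mem hsA) q (Finset.mem_insert_of_mem hq)
        (by rintro rfl; simp at hs; linarith)
      linarith
    -- `T` is holomorphic on the disc around any other point `q`, so passing from `F` to `E` leaves
    -- the principal part at `q` unchanged.
    have h0 : (∮ s in C(q, r), (z - s)⁻¹ * T s) = 0 := by
      refine DiffContOnCl.circleIntegral_eq_zero hr.le (DifferentiableOn.diffContOnCl fun s hs => ?_)
      exact (hTq s (closure_ball_subset_closedBall hs)).differentiableWithinAt
    have hTi : CircleIntegrable (fun s => (z - s)⁻¹ * T s) q r :=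
      ContinuousOn.circleIntegrable hr.le fun s hs =>
        (hTq s (sphere_subset_closedBall hs)).continuousAt.continuousWithinAt
    rw [← sub_zero (∮ s in C(q, r), (z - s)⁻¹ * F s), ← h0,
      ← circleIntegral.integral_sub (hFq.circleIntegrable hr.le) hTi]
    refine circleIntegral.integral_congr hr.le fun s hs => ?_
    rw [hEout s (hfar s (sphere_subset_closedBall hs))]
    ring

/-! ### Residues at an essential singularity. -/

open Filter Topology Metric in
/-- The residue at `0` of `g w / w ^ (q + 1) * exp (c / w)`, with `g` holomorphic at `0`, as a
series in the Taylor coefficients of `g`. -/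
theorem hasSum_residue_mul_exp_div {g : ℂ → ℂ} {r : ℝ} (hr : 0 < r)
    (hg : DifferentiableOn ℂ g (closedBall 0 r)) (q : ℕ) (c : ℂ) :
    HasSum (fun n : ℕ => 1 / ((n + q).factorial : ℂ) * iteratedDeriv (n + q) g 0 *
        (1 / (n.factorial : ℂ)) * c ^ n)
      ((2 * Real.pi * Complex.I)⁻¹ *
        ∮ w in C(0, r), g w / w ^ (q + 1) * Complex.exp (c / w)) := by
  have hmem : ∀ θ, circleMap 0 r θ ∈ sphere (0 : ℂ) r := fun θ => circleMap_mem_sphere 0 hr.le θ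
  have hne : ∀ θ, circleMap 0 r θ ≠ 0 := fun θ => circleMap_ne_center hr.ne'
  have hgc : Continuous fun θ => g (circleMap 0 r θ) :=
    (hg.continuousOn.mono sphere_subset_closedBall).comp_continuous (continuous_circleMap 0 r) hmem
  obtain ⟨B, hB⟩ := (isCompact_sphere (0 : ℂ) r).exists_bound_of_continuousOn
    (hg.continuousOn.mono sphere_subset_closedBall)
  -- The `n`-th term of the exponential series raises the power of `1 / w` to `n + q + 1`, so the
  -- integral is Cauchy's formula for the Taylor coefficient of order `n + q`.
  have hterm : ∀ n : ℕ, (∮ w in C(0, r), g w / w ^ (q + 1) * ((c / w) ^ n / n.factorial)) =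
      2 * Real.pi * Complex.I * (1 / ((n + q).factorial : ℂ) * iteratedDeriv (n + q) g 0 *
        (1 / (n.factorial : ℂ)) * c ^ n) := by
    intro n
    have h := hg.circleIntegral_one_div_sub_center_pow_smul hr (n + q)
    have e : (∮ w in C(0, r), g w / w ^ (q + 1) * ((c / w) ^ n / n.factorial)) =
        ∮ w in C(0, r), (c ^ n / n.factorial) * ((1 / (w - 0) ^ (n + q + 1)) • g w) := by
      refine circleIntegral.integral_congr hr.le fun w hw => ?_
      have hw0 : w ≠ 0 := by rintro rfl; simp at hw; linarith
      simp only [sub_zero, smul_eq_mul, div_pow]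
      field_simp
      ring
    rw [e, circleIntegral.integral_const_mul, h, smul_eq_mul]
    ring
  have hsum : HasSum (fun n : ℕ => ∮ w in C(0, r), g w / w ^ (q + 1) * ((c / w) ^ n / n.factorial))
      (∮ w in C(0, r), g w / w ^ (q + 1) * Complex.exp (c / w)) := by
    refine intervalIntegral.hasSum_integral_of_dominated_convergence
      (fun n _ => r * (B / r ^ (q + 1) * ((‖c‖ / r) ^ n / n.factorial))) (fun n => ?_)
      (fun n => ae_of_all _ fun θ _ => ?_) (ae_of_all _ fun θ _ => ?_) ?_
      (ae_of_all _ fun θ _ => ?_)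
    · have hdc : Continuous (deriv (circleMap 0 r)) := by
        have : deriv (circleMap 0 r) = fun θ => circleMap 0 r θ * Complex.I := by
          ext θ; simp
        rw [this]; fun_prop
      exact (hdc.smul ((hgc.div ((continuous_circleMap 0 r).pow _) fun θ => pow_ne_zero _ (hne θ)).mul
        (((continuous_const.div (continuous_circleMap 0 r) hne).pow n).div_const _))).aestronglyMeasurable
    · have h2 := hB _ (hmem θ)
      have h3 : ‖deriv (circleMap 0 r) θ‖ = r := by simp [abs_of_pos hr]
      have h4 : ‖circleMap 0 r θ‖ = r := by simp [abs_of_pos hr]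
      rw [norm_smul, h3, norm_mul, norm_div, norm_div, norm_pow, norm_pow, norm_div, h4,
        Complex.norm_natCast]
      gcongr
    · exact ((Real.summable_pow_div_factorial _).mul_left _).mul_left _
    · exact intervalIntegrable_const
    · refine HasSum.const_smul _ (HasSum.mul_left _ ?_)
      rw [Complex.exp_eq_exp_ℂ]
      exact NormedSpace.expSeries_div_hasSum_exp (c / circleMap 0 r θ)
  simp only [hterm] at hsum
  have h := hsum.mul_left (2 * Real.pi * Complex.I)⁻¹
  have := Complex.two_pi_I_ne_zero
  simpa only [inv_mul_cancel_left₀ this] using h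

/-! ### From characteristic function to density and tail. -/

/-- A finite measure whose characteristic function is the Fourier transform of an integrable real
function has that function as density. -/
theorem measureReal_eq_setIntegral_of_charFun_eq_ofReal {ν m : Measure ℝ} [IsFiniteMeasure ν]
    {h : ℝ → ℝ} (hh : Integrable h m)
    (hc : ∀ t : ℝ, charFun ν t = ∫ x, Complex.exp (t * x * Complex.I) * (h x : ℂ) ∂m)
    {s : Set ℝ} (hs : MeasurableSet s) : ν.real s = ∫ x in s, h x ∂m := by
  have f1 := isFiniteMeasure_withDensity_ofReal hh.2
  have f2 := isFiniteMeasure_withDensity_ofReal hh.neg.2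
  set m₁ := m.withDensity fun x => ENNReal.ofReal (h x) with hm₁
  set m₂ := m.withDensity fun x => ENNReal.ofReal ((-h) x) with hm₂
  have hint : ∀ (t : ℝ) (μ : Measure ℝ) [IsFiniteMeasure μ],
      Integrable (fun x : ℝ => Complex.exp (t * x * Complex.I)) μ := by
    intro t μ _
    refine Integrable.of_bound (by fun_prop) 1 (Filter.Eventually.of_forall fun x => ?_)
    rw [← Complex.ofReal_mul, Complex.norm_exp_ofReal_mul_I]
  have hmeas : AEMeasurable h m := hh.1.aemeasurable
  have hbd : ∀ (t : ℝ) (g : ℝ → ℝ), Integrable g m →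
      Integrable (fun x : ℝ => (g x).toNNReal • Complex.exp (t * x * Complex.I)) m := by
    intro t g hg
    refine Integrable.mono hg (by
      have := hg.1
      exact (this.aemeasurable.real_toNNReal.aestronglyMeasurable).smul (by fun_prop))
      (Filter.Eventually.of_forall fun x => ?_)
    rw [NNReal.smul_def, norm_smul, ← Complex.ofReal_mul, Complex.norm_exp_ofReal_mul_I, mul_one]
    simp [abs_le, le_abs, le_total]
  -- The sign of `h` is not known, so uniqueness of characteristic functions is applied to two
  -- genuine finite measures, with the negative part of `h` moved to the side of `ν`.
  have heq : ν + m₂ = m₁ := by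
    refine Measure.ext_of_charFun (funext fun t => ?_)
    have h1 : charFun m₁ t = ∫ x, (h x).toNNReal • Complex.exp (t * x * Complex.I) ∂m := by
      rw [charFun_apply_real, hm₁]
      exact integral_withDensity_eq_integral_smul₀ hmeas.real_toNNReal _
    have h2 : charFun m₂ t = ∫ x, ((-h) x).toNNReal • Complex.exp (t * x * Complex.I) ∂m := by
      rw [charFun_apply_real, hm₂]
      exact integral_withDensity_eq_integral_smul₀ hmeas.neg.real_toNNReal _
    have h3 : charFun (ν + m₂) t = charFun ν t + charFun m₂ t := by
      simp only [charFun_apply_real]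
      exact integral_add_measure (hint t ν) (hint t m₂)
    rw [h3, h1, h2, hc, ← eq_sub_iff_add_eq, ← integral_sub (hbd t h hh) (hbd t (-h) hh.neg)]
    refine integral_congr_ae (Filter.Eventually.of_forall fun x => ?_)
    simp only [NNReal.smul_def, Real.coe_toNNReal', Pi.neg_apply, Complex.real_smul]
    rw [← sub_mul, ← Complex.ofReal_sub, max_zero_sub_eq_self, mul_comm]
  have hrs : ν.real s + m₂.real s = m₁.real s := by
    rw [← heq, measureReal_add_apply]
  have e1 : m₁.real s = (∫⁻ x in s, ENNReal.ofReal (h x) ∂m).toReal := by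
    rw [measureReal_def, hm₁, withDensity_apply _ hs]
  have e2 : m₂.real s = (∫⁻ x in s, ENNReal.ofReal (-h x) ∂m).toReal := by
    rw [measureReal_def, hm₂, withDensity_apply _ hs]; rfl
  rw [integral_eq_lintegral_pos_part_sub_lintegral_neg_part hh.integrableOn, ← e1, ← e2, ← hrs]
  ring

/-- A finite measure whose characteristic function is the Fourier transform of an integrable
function has that function as density. -/
theorem measureReal_eq_setIntegral_of_charFun_eq {ν m : Measure ℝ} [IsFiniteMeasure ν]
    {f : ℝ → ℂ} (hf : Integrable f m)
    (hc : ∀ t : ℝ, charFun ν t = ∫ x, Complex.exp (t * x * Complex.I) * f x ∂m)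
    {s : Set ℝ} (hs : MeasurableSet s) : (ν.real s : ℂ) = ∫ x in s, f x ∂m := by
  -- As `ν` is a positive measure, `charFun ν (-t)` is the conjugate of `charFun ν t`, so the
  -- conjugate of `f` has the same transform. Hence `re f` represents `ν` and `im f` represents the
  -- zero measure.
  have hconj : ∀ t : ℝ, charFun ν t =
      ∫ x, Complex.exp (t * x * Complex.I) * (starRingEnd ℂ) (f x) ∂m := by
    intro t
    have h := charFun_neg (μ := ν) t
    rw [hc (-t)] at h
    rw [← Complex.conj_conj (charFun ν t), ← h, ← integral_conj]
    refine integral_congr_ae (Filter.Eventually.of_forall fun x => ?_)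
    simp [← Complex.exp_conj]
  have hb : ∀ (t : ℝ) (g : ℝ → ℂ), Integrable g m →
      Integrable (fun x : ℝ => Complex.exp (t * x * Complex.I) * g x) m := by
    intro t g hg
    refine hg.bdd_mul (c := 1) (by fun_prop) (Filter.Eventually.of_forall fun x => ?_)
    rw [← Complex.ofReal_mul, Complex.norm_exp_ofReal_mul_I]
  have hfc : Integrable (fun x => (starRingEnd ℂ) (f x)) m :=
    (Complex.conjCLE.toContinuousLinearMap.integrable_comp hf)
  have hre := measureReal_eq_setIntegral_of_charFun_eq_ofReal (ν := ν) hf.re (fun t => by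
    have e : ∀ x : ℝ, Complex.exp (t * x * Complex.I) * ((RCLike.re (f x) : ℝ) : ℂ) =
        2⁻¹ * (Complex.exp (t * x * Complex.I) * f x +
          Complex.exp (t * x * Complex.I) * (starRingEnd ℂ) (f x)) := fun x => by
      rw [← mul_add, Complex.add_conj]; simp; ring
    simp only [e]
    rw [integral_const_mul, integral_add (hb t _ hf) (hb t _ hfc), ← hc, ← hconj]
    ring) hs
  have him := measureReal_eq_setIntegral_of_charFun_eq_ofReal (ν := 0) hf.im (fun t => by
    have e : ∀ x : ℝ, Complex.exp (t * x * Complex.I) * ((RCLike.im (f x) : ℝ) : ℂ) =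
        (2 * Complex.I)⁻¹ * (Complex.exp (t * x * Complex.I) * f x -
          Complex.exp (t * x * Complex.I) * (starRingEnd ℂ) (f x)) := fun x => by
      rw [← mul_sub, Complex.sub_conj]; simp; field_simp; rw [Complex.I_sq]; ring
    simp only [e]
    rw [integral_const_mul, integral_sub (hb t _ hf) (hb t _ hfc), ← hc, ← hconj]
    simp [charFun_zero_measure]) hs
  have h1 := integral_re (𝕜 := ℂ) (f := f) (μ := m.restrict s) hf.integrableOn
  have h2 := integral_im (𝕜 := ℂ) (f := f) (μ := m.restrict s) hf.integrableOn
  apply Complex.ext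
  · exact hre.trans h1
  · have := him.trans h2
    simpa using this

open Metric in
/-- The one-sided Laplace transform, from `a` on, of the inverse Laplace integral over a circle in
the open left half-plane. -/
theorem integral_Ioi_exp_mul_circleIntegral {F : ℂ → ℂ} {p : ℂ} {r : ℝ} (hr : 0 ≤ r)
    (hF : ContinuousOn F (sphere p r)) (hre : p.re + r < 0) {a : ℝ} (ha : 0 ≤ a) {z : ℂ} (hz : 0 ≤ z.re) :
    IntegrableOn (fun x : ℝ => Complex.exp (-z * x) * ∮ s in C(p, r), Complex.exp (x * s) * F s)
        (Set.Ioi a) ∧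
      ∫ x in Set.Ioi a, Complex.exp (-z * x) * ∮ s in C(p, r), Complex.exp (x * s) * F s =
        ∮ s in C(p, r), Complex.exp (-(z - s) * a) * ((z - s)⁻¹ * F s) := by
  have hmem : ∀ θ, circleMap p r θ ∈ sphere p r := fun θ => circleMap_mem_sphere p hr θ
  have hsre : ∀ θ, (circleMap p r θ).re ≤ p.re + r := by
    intro θ
    have h := hmem θ
    rw [mem_sphere, dist_eq_norm] at h
    have := (Complex.abs_re_le_norm (circleMap p r θ - p))
    rw [h, Complex.sub_re, abs_le] at this
    linarith [this.2]
  have hFc : Continuous fun θ => F (circleMap p r θ) :=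
    hF.comp_continuous (continuous_circleMap p r) hmem
  have hdc : Continuous (deriv (circleMap p r)) := by
    have : deriv (circleMap p r) = fun θ => circleMap 0 r θ * Complex.I := by
      ext θ; simp
    rw [this]; fun_prop
  obtain ⟨B, hB⟩ := (isCompact_sphere p r).exists_bound_of_continuousOn hF
  set f : ℝ → ℝ → ℂ := fun θ x => Complex.exp (-z * x) *
    (deriv (circleMap p r) θ * (Complex.exp (x * circleMap p r θ) * F (circleMap p r θ))) with hf
  have hfc : Continuous (Function.uncurry f) := by
    simp only [hf, Function.uncurry_def]
    have c1 := hdc.comp (continuous_fst (X := ℝ) (Y := ℝ))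
    have c2 := hFc.comp (continuous_fst (X := ℝ) (Y := ℝ))
    have c3 := (continuous_circleMap p r).comp (continuous_fst (X := ℝ) (Y := ℝ))
    have c4 := Complex.continuous_ofReal.comp (continuous_snd (X := ℝ) (Y := ℝ))
    exact (Complex.continuous_exp.comp (continuous_const.mul c4)).mul
      (c1.mul ((Complex.continuous_exp.comp (c4.mul c3)).mul c2))
  -- Fubini's theorem is justified by the majorant `r * B * exp ((p.re + r) * x)`, integrable
  -- because the circle lies in the open left half-plane.
  have hint : Integrable (Function.uncurry f)
      ((volume.restrict (Set.uIoc 0 (2 * Real.pi))).prod (volume.restrict (Set.Ioi a))) := by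
    rw [Set.uIoc_of_le Real.two_pi_pos.le]
    have hc : Integrable (fun _ : ℝ => r * B) (volume.restrict (Set.Ioc 0 (2 * Real.pi))) :=
      integrable_const _
    refine (hc.mul_prod (integrableOn_exp_mul_Ioi hre a)).mono' hfc.aestronglyMeasurable ?_
    rw [Measure.prod_restrict]
    refine (ae_restrict_iff' (measurableSet_Ioc.prod measurableSet_Ioi)).2
      (Filter.Eventually.of_forall fun y hy => ?_)
    have hx : 0 < y.2 := ha.trans_lt hy.2
    simp only [Function.uncurry_def, hf, norm_mul, Complex.norm_exp]
    have h3 : ‖deriv (circleMap p r) y.1‖ = r := by simp [abs_of_nonneg hr]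
    have h4 : (-z * (y.2 : ℂ)).re = -z.re * y.2 := by simp
    have h5 : ((y.2 : ℂ) * circleMap p r y.1).re = y.2 * (circleMap p r y.1).re := by
      rw [Complex.re_ofReal_mul]
    have h6 : Real.exp (-z.re * y.2) ≤ 1 := Real.exp_le_one_iff.2 (by nlinarith)
    have h7 : Real.exp (y.2 * (circleMap p r y.1).re) ≤ Real.exp ((p.re + r) * y.2) :=
      Real.exp_le_exp.2 (by nlinarith [hsre y.1])
    have h8 := hB _ (hmem y.1)
    rw [h3, h4, h5]
    calc Real.exp (-z.re * y.2) * (r * (Real.exp (y.2 * (circleMap p r y.1).re) *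
          ‖F (circleMap p r y.1)‖)) ≤ 1 * (r * (Real.exp ((p.re + r) * y.2) * B)) := by gcongr
      _ = r * B * Real.exp ((p.re + r) * y.2) := by ring
  have hcirc : ∀ x : ℝ, (Complex.exp (-z * x) * ∮ s in C(p, r), Complex.exp (x * s) * F s) =
      ∫ θ in 0..2 * Real.pi, f θ x := by
    intro x
    simp only [hf, circleIntegral, smul_eq_mul, intervalIntegral.integral_const_mul]
  simp only [hcirc]
  constructor
  · simp only [intervalIntegral.integral_of_le Real.two_pi_pos.le]
    rw [Set.uIoc_of_le Real.two_pi_pos.le] at hint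
    exact hint.integral_prod_right
  · rw [← intervalIntegral_integral_swap hint, circleIntegral]
    refine intervalIntegral.integral_congr fun θ _ => ?_
    have hlt : (circleMap p r θ - z).re < 0 := by
      rw [Complex.sub_re]; linarith [hsre θ]
    have hne : z - circleMap p r θ ≠ 0 := fun h => by
      rw [← neg_sub, h, neg_zero] at hlt; simp at hlt
    have e : ∀ x : ℝ, f θ x = deriv (circleMap p r) θ * F (circleMap p r θ) *
        Complex.exp ((circleMap p r θ - z) * x) := fun x => by
      have : (circleMap p r θ - z) * x = -z * x + x * circleMap p r θ := by ring
      rw [this, Complex.exp_add]; simp only [hf]; ring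
    simp only [e]
    rw [integral_const_mul, integral_exp_mul_complex_Ioi hlt, smul_eq_mul,
      ← neg_sub z, div_neg, neg_div, neg_neg]
    ring

open Metric Filter Topology in
/-- Tail probabilities of a law whose characteristic function extends to a function holomorphic off
finitely many points of the open left half-plane and vanishing at infinity. -/
theorem measureReal_Ici_eq_neg_sum_circleIntegral {ν : Measure ℝ} [IsFiniteMeasure ν]
    (A : Finset ℂ) {r : ℝ} (hr : 0 < r) {F : ℂ → ℂ} (hF : ∀ s ∉ A, DifferentiableAt ℂ F s)
    (hlim : Tendsto F (cocompact ℂ) (𝓝 0))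
    (hsep : ∀ p ∈ A, ∀ q ∈ A, p ≠ q → 2 * r < dist p q) (hre : ∀ p ∈ A, p.re + r < 0)
    (hc : ∀ t : ℝ, charFun ν t = F (-(t * Complex.I))) {a : ℝ} (ha : 0 ≤ a) :
    (ν.real (Set.Ici a) : ℂ) = -∑ p ∈ A, (2 * Real.pi * Complex.I)⁻¹ *
      ∮ s in C(p, r), Complex.exp (a * s) / s * F s := by
  have hcirc : ∀ p ∈ A, ContinuousOn F (sphere p r) := by
    intro p hp s hs
    rw [mem_sphere] at hs
    refine (hF s fun hsA => ?_).continuousAt.continuousWithinAt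
    have := hsep s hsA p hp (by rintro rfl; simp at hs; linarith)
    linarith
  set f : ℝ → ℂ := fun x => ∑ p ∈ A, (2 * Real.pi * Complex.I)⁻¹ *
    ∮ s in C(p, r), Complex.exp (x * s) * F s with hf
  have hfi : IntegrableOn f (Set.Ioi 0) := by
    refine integrable_finsetSum _ fun p hp => Integrable.const_mul ?_ _
    simpa [IntegrableOn] using (integral_Ioi_exp_mul_circleIntegral hr.le (hcirc p hp) (hre p hp)
      le_rfl (z := 0) le_rfl).1
  have htrans : ∀ (z : ℂ) (_ : 0 ≤ z.re) (a : ℝ) (_ : 0 ≤ a), ∫ x in Set.Ioi a, Complex.exp (-z * x) * f x =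
      ∑ p ∈ A, (2 * Real.pi * Complex.I)⁻¹ *
        ∮ s in C(p, r), Complex.exp (-(z - s) * a) * ((z - s)⁻¹ * F s) := by
    intro z hz a ha
    have e : ∀ x : ℝ, Complex.exp (-z * x) * f x = ∑ p ∈ A, (2 * Real.pi * Complex.I)⁻¹ *
        (Complex.exp (-z * x) * ∮ s in C(p, r), Complex.exp (x * s) * F s) := fun x => by
      rw [hf, Finset.mul_sum]
      exact Finset.sum_congr rfl fun p _ => by ring
    simp only [e]
    rw [integral_finsetSum _ fun p hp => Integrable.const_mul
      (integral_Ioi_exp_mul_circleIntegral hr.le (hcirc p hp) (hre p hp) ha hz).1 _]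
    refine Finset.sum_congr rfl fun p hp => ?_
    rw [integral_const_mul,
      (integral_Ioi_exp_mul_circleIntegral hr.le (hcirc p hp) (hre p hp) ha hz).2]
  have hchar : ∀ t : ℝ, charFun ν t =
      ∫ x in Set.Ioi (0 : ℝ), Complex.exp (t * x * Complex.I) * f x := by
    intro t
    have hz : (0 : ℝ) ≤ (-(t * Complex.I)).re := by simp
    have h := htrans _ hz 0 le_rfl
    have e : ∀ x : ℝ, (t : ℂ) * x * Complex.I = -(-(t * Complex.I)) * x := fun x => by ring
    simp only [e]
    rw [h, hc, eq_sum_circleIntegral_of_tendsto_zero A hr hF hlim hsep (fun p hp => ?_)]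
    · simp
    -- A point of the imaginary axis is at distance at least `-p.re > r` from `p`, hence outside
    -- every circle.
    · have h1 := Complex.abs_re_le_norm (-(t * Complex.I) - p)
      rw [dist_eq_norm]
      refine lt_of_lt_of_le ?_ ((le_abs_self _).trans h1)
      have := hre p hp
      simp; linarith
  rw [measureReal_eq_setIntegral_of_charFun_eq hfi hchar measurableSet_Ici,
    Measure.restrict_restrict measurableSet_Ici]
  have hset : (Set.Ici a ∩ Set.Ioi 0 : Set ℝ) =ᵐ[volume] Set.Ioi a := by
    have h1 : (Set.Ici a ∩ Set.Ioi 0 : Set ℝ) =ᵐ[volume] (Set.Ioi a ∩ Set.Ioi 0 : Set ℝ) :=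
      Ioi_ae_eq_Ici.symm.inter (ae_eq_refl _)
    rwa [Set.Ioi_inter_Ioi, sup_eq_left.2 ha] at h1
  rw [setIntegral_congr_set hset]
  have h := htrans 0 le_rfl a ha
  simp only [neg_zero, zero_mul, Complex.exp_zero, one_mul] at h
  rw [h, ← Finset.sum_neg_distrib]
  refine Finset.sum_congr rfl fun p _ => ?_
  -- The tail integral is the transform at `z = 0`; its factor `(0 - s)⁻¹` is the source of the
  -- minus sign in the final formula.
  have e : (∮ s in C(p, r), Complex.exp (-(0 - s) * a) * ((0 - s)⁻¹ * F s)) =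
      ∮ s in C(p, r), (-1) * (Complex.exp (a * s) / s * F s) := by
    refine circleIntegral.integral_congr hr.le fun s _ => ?_
    simp only [zero_sub, neg_neg, inv_neg]
    ring_nf
  rw [circleIntegral.integral_const_mul] at e
  simp only [neg_mul, one_mul] at e ⊢
  rw [e, mul_neg]

/-! ### Circularly-symmetric complex Gaussian vectors. -/

theorem integral_complexGaussian {E : Type*} [NormedAddCommGroup E] [NormedSpace ℝ E] (v : ℝ≥0)
    (f : ℂ → E) : ∫ z, f z ∂complexGaussian v =
      ∫ p, f ⟨p.1, p.2⟩ ∂(gaussianReal 0 (v / 2)).prod (gaussianReal 0 (v / 2)) :=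
  integral_map_equiv Complex.measurableEquivRealProd.symm f

instance isProbabilityMeasure_complexGaussian (v : ℝ≥0) :
    IsProbabilityMeasure (complexGaussian v) :=
  Measure.isProbabilityMeasure_map Complex.measurableEquivRealProd.symm.measurable.aemeasurable

/-- Independence splits the integral into two real Gaussian characteristic functions of variance `v
/ 2`. The exponent depends only on the length of the vector representing `L`: this is circular
symmetry. -/
theorem charFunDual_complexGaussian (v : ℝ≥0) (L : StrongDual ℝ ℂ) :
    charFunDual (complexGaussian v) L =
      Complex.exp (-(v / 4 * (L 1 ^ 2 + L Complex.I ^ 2) : ℝ)) := by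
  have hL : ∀ x y : ℝ, L ⟨x, y⟩ = L 1 * x + L Complex.I * y := by
    intro x y
    have : (⟨x, y⟩ : ℂ) = x • (1 : ℂ) + y • Complex.I := by
      apply Complex.ext <;> simp
    rw [this, map_add, map_smul, map_smul]
    simp [mul_comm]
  rw [charFunDual_apply, integral_complexGaussian]
  have e : ∀ p : ℝ × ℝ, Complex.exp ((L ⟨p.1, p.2⟩ : ℝ) * Complex.I) =
      Complex.exp ((L 1 : ℝ) * p.1 * Complex.I) *
        Complex.exp ((L Complex.I : ℝ) * p.2 * Complex.I) := by
    intro p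
    rw [hL, ← Complex.exp_add]
    push_cast
    ring_nf
  simp only [e]
  rw [integral_prod_mul (fun x : ℝ => Complex.exp ((L 1 : ℝ) * x * Complex.I))
    (fun x : ℝ => Complex.exp ((L Complex.I : ℝ) * x * Complex.I)), ← charFun_apply_real,
    ← charFun_apply_real, charFun_gaussianReal, charFun_gaussianReal, ← Complex.exp_add]
  congr 1
  push_cast
  ring

theorem memLp_two_complexGaussian (v : ℝ≥0) : MemLp (fun z : ℂ => z) 2 (complexGaussian v) := by
  have h1 := memLp_id_gaussianReal' (μ := 0) (v := v / 2) 2 (by simp)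
  refine (MeasurableEquiv.memLp_map_measure_iff (f := Complex.measurableEquivRealProd.symm)).2 ?_
  have hx : MemLp (fun p : ℝ × ℝ => (p.1 : ℂ)) 2
      ((gaussianReal 0 (v / 2)).prod (gaussianReal 0 (v / 2))) :=
    (h1.comp_fst _).ofReal
  have hy : MemLp (fun p : ℝ × ℝ => (p.2 : ℂ)) 2
      ((gaussianReal 0 (v / 2)).prod (gaussianReal 0 (v / 2))) :=
    (h1.comp_snd _).ofReal
  refine (hx.add (hy.const_mul Complex.I)).ae_eq (Filter.Eventually.of_forall fun p => ?_)
  apply Complex.ext <;> simp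

theorem integral_id_complexGaussian (v : ℝ≥0) : ∫ z, z ∂complexGaussian v = 0 := by
  have hi := (memLp_two_complexGaussian v).integrable (by norm_num)
  have h1 := integral_re (𝕜 := ℂ) hi
  have h2 := integral_im (𝕜 := ℂ) hi
  apply Complex.ext
  · refine h1.symm.trans ?_
    rw [integral_complexGaussian]
    simpa using integral_fun_fst (μ := gaussianReal 0 (v / 2)) (ν := gaussianReal 0 (v / 2))
      (fun x : ℝ => x)
  · refine h2.symm.trans ?_
    rw [integral_complexGaussian]
    simpa using integral_fun_snd (μ := gaussianReal 0 (v / 2)) (ν := gaussianReal 0 (v / 2))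
      (fun x : ℝ => x)

theorem integral_mul_star_complexGaussian (v : ℝ≥0) :
    ∫ z, z * star z ∂complexGaussian v = v := by
  have hsq : ∫ x, x ^ 2 ∂gaussianReal 0 (v / 2) = (v / 2 : ℝ) := by
    have h := variance_of_integral_eq_zero (μ := gaussianReal 0 (v / 2)) (X := fun x => x)
      aemeasurable_id' integral_id_gaussianReal
    rw [← h, variance_fun_id_gaussianReal]; simp
  have hint : Integrable (fun x : ℝ => x ^ 2) (gaussianReal 0 (v / 2)) :=
    (memLp_id_gaussianReal' (μ := 0) (v := v / 2) 2 (by simp)).integrable_sq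
  have e : ∀ z : ℂ, z * star z = ((z.re ^ 2 + z.im ^ 2 : ℝ) : ℂ) := fun z => by
    rw [Complex.star_def, Complex.mul_conj, Complex.normSq_apply]; push_cast; ring
  simp only [e]
  rw [integral_complex_ofReal, integral_complexGaussian]
  rw [integral_add (hint.comp_fst _) (hint.comp_snd _)]
  have i1 := integral_fun_fst (μ := gaussianReal 0 (v / 2)) (ν := gaussianReal 0 (v / 2))
      (fun x : ℝ => x ^ 2)
  have i2 := integral_fun_snd (μ := gaussianReal 0 (v / 2)) (ν := gaussianReal 0 (v / 2))
      (fun x : ℝ => x ^ 2)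
  rw [i1, i2, hsq]
  simp

section Pi

variable {E : Type*} [Fintype E]

theorem memLp_eval_pi_complexGaussian (v : ℝ≥0) (e : E) :
    MemLp (fun h : E → ℂ => h e) 2 (Measure.pi fun _ => complexGaussian v) :=
  (memLp_two_complexGaussian v).comp_measurePreserving (measurePreserving_eval _ e)

theorem integral_eval_pi_complexGaussian (v : ℝ≥0) (e : E) :
    ∫ h : E → ℂ, h e ∂(Measure.pi fun _ => complexGaussian v) = 0 := by
  have hm := measurePreserving_eval (fun _ : E => complexGaussian v) e
  have h := integral_map (μ := Measure.pi fun _ : E => complexGaussian v) (f := fun z : ℂ => z) hm.measurable.aemeasurable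
    (by fun_prop : AEStronglyMeasurable _ _)
  rw [hm.map_eq, integral_id_complexGaussian] at h
  exact h.symm

theorem integral_mul_star_pi_complexGaussian [DecidableEq E] (v : ℝ≥0) (e f : E) :
    ∫ h : E → ℂ, h e * star (h f) ∂(Measure.pi fun _ => complexGaussian v) =
      if e = f then (v : ℂ) else 0 := by
  split_ifs with hef
  · subst hef
    have hm := measurePreserving_eval (fun _ : E => complexGaussian v) e
    have h := integral_map (μ := Measure.pi fun _ : E => complexGaussian v) (f := fun z : ℂ => z * star z) hm.measurable.aemeasurable
      (continuous_id.mul continuous_star).aestronglyMeasurable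
    rw [hm.map_eq, integral_mul_star_complexGaussian] at h
    exact h.symm
  · have hind := (iIndepFun_pi (μ := fun _ : E => complexGaussian v) (X := fun _ z => z)
      fun _ => aemeasurable_id').indepFun hef
    have h2 := hind.comp measurable_id (continuous_star (R := ℂ)).measurable
    have h3 := h2.integral_fun_mul_eq_mul_integral (measurable_pi_apply e).aestronglyMeasurable
      (continuous_star.measurable.comp (measurable_pi_apply f)).aestronglyMeasurable
    refine h3.trans ?_
    simp [integral_eval_pi_complexGaussian]

theorem integrable_mulVec_pi_complexGaussian {n : Type*} (v : ℝ≥0) (A : Matrix n E ℂ) (p : n) :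
    Integrable (fun h => (A *ᵥ h) p) (Measure.pi fun _ : E => complexGaussian v) :=
  integrable_finsetSum _ fun e _ =>
    ((memLp_eval_pi_complexGaussian v e).integrable (by norm_num)).const_mul _

theorem integral_mulVec_pi_complexGaussian {n : Type*} (v : ℝ≥0) (A : Matrix n E ℂ) (p : n) :
    ∫ h, (A *ᵥ h) p ∂(Measure.pi fun _ : E => complexGaussian v) = 0 := by
  simp only [Matrix.mulVec, dotProduct]
  rw [integral_finsetSum _ fun e _ =>
    ((memLp_eval_pi_complexGaussian v e).integrable (by norm_num)).const_mul _]
  simp [integral_const_mul, integral_eval_pi_complexGaussian]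

theorem integral_mulVec_mul_star_pi_complexGaussian {n : Type*} (v : ℝ≥0) (A : Matrix n E ℂ)
    (p q : n) : ∫ h, (A *ᵥ h) p * star ((A *ᵥ h) q) ∂(Measure.pi fun _ : E => complexGaussian v) =
      v * (A * Aᴴ) p q := by
  classical
  have hint : ∀ e f : E, Integrable (fun h : E → ℂ => (A p e * star (A q f)) * (h e * star (h f)))
      (Measure.pi fun _ : E => complexGaussian v) := fun e f => by
    refine Integrable.const_mul ?_ _
    exact (memLp_eval_pi_complexGaussian v e).integrable_mul
      (memLp_eval_pi_complexGaussian v f).star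
  have e : ∀ h : E → ℂ, (A *ᵥ h) p * star ((A *ᵥ h) q) =
      ∑ e, ∑ f, (A p e * star (A q f)) * (h e * star (h f)) := fun h => by
    simp only [Matrix.mulVec, dotProduct, star_sum, Finset.sum_mul_sum, star_mul]
    exact Finset.sum_congr rfl fun _ _ => Finset.sum_congr rfl fun _ _ => by ring
  simp only [e]
  rw [integral_finsetSum _ fun e _ => integrable_finsetSum _ fun f _ => hint e f]
  simp only [integral_finsetSum _ fun f _ => hint _ f, integral_const_mul,
    integral_mul_star_pi_complexGaussian, mul_ite, mul_zero, Finset.sum_ite_eq, Finset.mem_univ,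
    if_true, Matrix.mul_apply, Matrix.conjTranspose_apply]
  rw [Finset.mul_sum]
  exact Finset.sum_congr rfl fun _ _ => by ring

/-- A linear image, with covariance the identity, of a vector of i.i.d. circularly-symmetric complex
Gaussians is a vector of i.i.d. standard ones. -/
theorem map_mulVec_pi_complexGaussian {n : Type*} [Fintype n] [DecidableEq n] (v : ℝ≥0)
    (C : Matrix n E ℂ) (hC : (v : ℂ) • (C * Cᴴ) = 1) :
    (Measure.pi fun _ : E => complexGaussian v).map (fun h => C *ᵥ h) =
      Measure.pi fun _ : n => complexGaussian 1 := by
  classical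
  set T : (E → ℂ) →L[ℝ] (n → ℂ) :=
    (LinearMap.toContinuousLinearMap (C.mulVecLin)).restrictScalars ℝ with hT
  have hmap : (fun h => C *ᵥ h) = T := rfl
  rw [hmap]
  have := Measure.isProbabilityMeasure_map (μ := Measure.pi fun _ : E => complexGaussian v)
    T.continuous.measurable.aemeasurable
  refine Measure.ext_of_charFunDual (funext fun L => ?_)
  rw [charFunDual_map, charFunDual_pi, charFunDual_pi]
  simp only [charFunDual_complexGaussian, ← Complex.exp_sum]
  congr 1
  simp only [Finset.sum_neg_distrib, ← Complex.ofReal_sum, ← Finset.mul_sum]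
  congr 2
  -- The vector `c` represents the real functional `L` as `x ↦ Re (cᴴ x)`, and `d` represents its
  -- pullback along `C`. The characteristic functions involve only `‖c‖²` and `v ‖d‖²`, which agree
  -- since `v C Cᴴ = 1`.
  set c : n → ℂ := fun p => ⟨L (Pi.single p 1), L (Pi.single p Complex.I)⟩ with hc
  have hLs : ∀ x : n → ℂ, L x = (∑ p, star (c p) * x p).re := by
    intro x
    have hx : x = ∑ p, ((x p).re • (Pi.single p 1 : n → ℂ) +
        (x p).im • (Pi.single p Complex.I : n → ℂ)) := by
      ext q
      simp only [Finset.sum_apply, Pi.add_apply, Pi.smul_apply, Pi.single_apply]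
      rw [Finset.sum_eq_single q (fun p _ hp => by simp [Ne.symm hp]) (by simp)]
      simp
    conv_lhs => rw [hx]
    rw [map_sum, Complex.re_sum]
    refine Finset.sum_congr rfl fun p _ => ?_
    rw [map_add, map_smul, map_smul]
    simp [hc]; ring
  set d : E → ℂ := fun e => ∑ p, star (c p) * C p e with hd
  have hL1 : ∀ e (w : ℂ), L (C *ᵥ Pi.single e w) = (d e * w).re := by
    intro e w
    rw [hLs, hd]
    simp only [Matrix.mulVec_single, Finset.sum_mul]
    congr 1
    exact Finset.sum_congr rfl fun p _ => by simp [mul_assoc]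
  have key : (v : ℂ) * ∑ e, d e * star (d e) = ∑ p, c p * star (c p) := by
    have h1 : ∑ e, d e * star (d e) = star c ⬝ᵥ ((C * Cᴴ) *ᵥ c) := by
      have hd' : d = star c ᵥ* C := rfl
      rw [← Matrix.mulVec_mulVec, Matrix.dotProduct_mulVec, ← hd']
      have hds : star d = Cᴴ *ᵥ c := by rw [hd', Matrix.star_vecMul, star_star]
      rw [← hds]; rfl
    rw [h1, ← smul_eq_mul, ← dotProduct_smul, ← Matrix.smul_mulVec, hC, Matrix.one_mulVec]
    simp [dotProduct, mul_comm]
  have key' : (v : ℝ) * ∑ e, ‖d e‖ ^ 2 = ∑ p, ‖c p‖ ^ 2 := by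
    have hn : ∀ z : ℂ, z * star z = ((‖z‖ ^ 2 : ℝ) : ℂ) := fun z => by
      rw [Complex.star_def, Complex.mul_conj, Complex.normSq_eq_norm_sq]
    simp only [hn] at key
    exact_mod_cast key
  have hn : ∀ z : ℂ, ‖z‖ ^ 2 = z.re ^ 2 + z.im ^ 2 := fun z => by
    rw [← Complex.normSq_eq_norm_sq, Complex.normSq_apply]; ring
  have e1 : ∀ e, ((L.comp T).comp (ContinuousLinearMap.single ℝ (fun _ : E => ℂ) e)) 1 ^ 2 +
      ((L.comp T).comp (ContinuousLinearMap.single ℝ (fun _ : E => ℂ) e)) Complex.I ^ 2 =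
        ‖d e‖ ^ 2 := fun e => by
    have h1 := hL1 e 1
    have h2 := hL1 e Complex.I
    simp only [mul_one, Complex.mul_I_re] at h1 h2
    rw [hn, ← h1, ← neg_sq (d e).im, ← h2]
    rfl
  have e2 : ∀ p, (L.comp (ContinuousLinearMap.single ℝ (fun _ : n => ℂ) p)) 1 ^ 2 +
      (L.comp (ContinuousLinearMap.single ℝ (fun _ : n => ℂ) p)) Complex.I ^ 2 = ‖c p‖ ^ 2 :=
    fun p => by rw [hn]; rfl
  simp only [e1, e2, ← key']
  simp
  ring

end Pi

/-! ### Laplace transforms of noncentral Gaussian quadratic forms. -/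

theorem integral_exp_neg_mul_sq_gaussianReal {t : ℂ} (ht : 0 ≤ t.re) (α : ℝ) :
    ∫ x : ℝ, Complex.exp (-t * (x + α) ^ 2) ∂gaussianReal 0 (1 / 2) =
      (Real.sqrt Real.pi : ℂ)⁻¹ * (Real.pi / (1 + t)) ^ (1 / 2 : ℂ) *
        Complex.exp (-(t * α ^ 2 / (1 + t))) := by
  have h1 : (1 + t) ≠ 0 := fun h => by
    have := congrArg Complex.re h
    simp at this; linarith
  rw [integral_gaussianReal_eq_integral_smul (by norm_num)]
  have e : ∀ x : ℝ, gaussianPDFReal 0 (1 / 2) x • Complex.exp (-t * (x + α) ^ 2) =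
      (Real.sqrt Real.pi : ℂ)⁻¹ * Complex.exp (-(1 + t) * x ^ 2 + (-(2 * t * α)) * x + -(t * α ^ 2)) := by
    intro x
    have h2 : (2 : ℝ) * Real.pi * ((1 / 2 : ℝ≥0) : ℝ) = Real.pi := by push_cast; ring
    rw [gaussianPDFReal, Complex.real_smul, h2]
    push_cast
    rw [mul_assoc, ← Complex.exp_add]
    congr 2
    norm_num; ring
  simp only [e]
  rw [integral_const_mul, integral_cexp_quadratic (by simp; linarith), neg_neg,
    ← mul_assoc]
  congr 2
  rw [neg_sq, mul_neg, div_neg, sub_neg_eq_add]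
  field_simp
  ring

/-- Real and imaginary parts contribute equal square-root factors. Their product is a square, so the
choice of branch disappears. -/
theorem integral_exp_neg_mul_normSq_complexGaussian {t : ℂ} (ht : 0 ≤ t.re) (χ : ℂ) :
    ∫ w : ℂ, Complex.exp (-t * (‖w + χ‖ ^ 2 : ℝ)) ∂complexGaussian 1 =
      (1 + t)⁻¹ * Complex.exp (-(t * (‖χ‖ ^ 2 : ℝ) / (1 + t))) := by
  have h1 : (1 + t) ≠ 0 := fun h => by
    have := congrArg Complex.re h
    simp at this; linarith
  have e : ∀ p : ℝ × ℝ, Complex.exp (-t * (‖(⟨p.1, p.2⟩ : ℂ) + χ‖ ^ 2 : ℝ)) =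
      Complex.exp (-t * (p.1 + χ.re) ^ 2) * Complex.exp (-t * (p.2 + χ.im) ^ 2) := by
    intro p
    rw [← Complex.exp_add, ← Complex.normSq_eq_norm_sq, Complex.normSq_apply]
    congr 1
    simp; ring
  have hπ : (Real.sqrt Real.pi : ℂ) ^ 2 = Real.pi := by
    rw [← Complex.ofReal_pow, Real.sq_sqrt Real.pi_pos.le]
  have hπ0 : (Real.pi : ℂ) ≠ 0 := by exact_mod_cast Real.pi_ne_zero
  have hsq : ((Real.pi / (1 + t)) ^ (1 / 2 : ℂ)) ^ 2 = (Real.pi / (1 + t) : ℂ) := by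
    rw [← Complex.cpow_nat_mul]; norm_num
  rw [integral_complexGaussian]
  simp only [e]
  rw [integral_prod_mul (fun x : ℝ => Complex.exp (-t * (x + χ.re) ^ 2))
    (fun x : ℝ => Complex.exp (-t * (x + χ.im) ^ 2)),
    integral_exp_neg_mul_sq_gaussianReal ht, integral_exp_neg_mul_sq_gaussianReal ht,
    ← Complex.normSq_eq_norm_sq, Complex.normSq_apply]
  calc _ = ((Real.sqrt Real.pi : ℂ) ^ 2)⁻¹ * ((Real.pi / (1 + t)) ^ (1 / 2 : ℂ)) ^ 2 *
        (Complex.exp (-(t * χ.re ^ 2 / (1 + t))) * Complex.exp (-(t * χ.im ^ 2 / (1 + t)))) := by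
        ring
    _ = _ := by
      rw [hπ, hsq, ← Complex.exp_add]
      congr 1
      · field_simp
      · congr 1
        push_cast
        ring

theorem integral_exp_neg_mul_sum_pi_complexGaussian {n : Type*} [Fintype n] {lam : n → ℝ}
    (hlam : ∀ q, 0 ≤ lam q) (χ : n → ℂ) {z : ℂ} (hz : 0 ≤ z.re) :
    ∫ w : n → ℂ, Complex.exp (-z * (∑ q, lam q * ‖w q + χ q‖ ^ 2 : ℝ))
        ∂(Measure.pi fun _ => complexGaussian 1) =
      ∏ q, ((1 + z * lam q)⁻¹ * Complex.exp (-(z * lam q * (‖χ q‖ ^ 2 : ℝ) / (1 + z * lam q)))) := by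
  have e : ∀ w : n → ℂ, Complex.exp (-z * (∑ q, lam q * ‖w q + χ q‖ ^ 2 : ℝ)) =
      ∏ q, Complex.exp (-(z * lam q) * (‖w q + χ q‖ ^ 2 : ℝ)) := by
    intro w
    rw [← Complex.exp_sum]
    push_cast
    rw [Finset.mul_sum]
    congr 1
    exact Finset.sum_congr rfl fun q _ => by ring
  simp only [e]
  rw [integral_fintype_prod_eq_prod (𝕜 := ℂ)
    (fun q w => Complex.exp (-(z * lam q) * (‖w + χ q‖ ^ 2 : ℝ)))]
  refine Finset.prod_congr rfl fun q _ => integral_exp_neg_mul_normSq_complexGaussian ?_ _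
  rw [Complex.re_mul_ofReal]
  exact mul_nonneg hz (hlam q)

theorem circleIntegral_comp_add_center (f : ℂ → ℂ) (c : ℂ) (r : ℝ) :
    (∮ s in C(c, r), f s) = ∮ w in C(0, r), f (w + c) := by
  simp [circleIntegral, circleMap, deriv_circleMap, add_comm]

theorem ofReal_sum_norm_sq {m : Type*} [Fintype m] (y : m → ℂ) :
    ((∑ p, ‖y p‖ ^ 2 : ℝ) : ℂ) = star y ⬝ᵥ y := by
  simp only [dotProduct, Pi.star_apply, Complex.star_def, Complex.ofReal_sum]
  exact Finset.sum_congr rfl fun p _ => by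
    rw [mul_comm, Complex.mul_conj, Complex.normSq_eq_norm_sq]

/-! ### Whitening, the Laplace transform and its singularities. -/

namespace EigenDecomposition

variable {n : Type*} [Fintype n] [DecidableEq n] {A : Matrix n n ℂ} (D : EigenDecomposition A)

theorem eig_pos (hA : A.PosDef) (i : Fin D.num) : 0 < D.eig i := by
  have hdiag : D.Psiᴴ * A * D.Psi = Matrix.diagonal fun p => (D.eig p.1 : ℂ) := by
    have h := D.decomposition
    calc D.Psiᴴ * A * D.Psi = D.Psiᴴ * (D.Psi *
          (Matrix.diagonal (fun p => (D.eig p.1 : ℂ)) : Matrix (Σ i, Fin (D.mult i)) _ ℂ) *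
          D.Psiᴴ) * D.Psi := by rw [← h]
      _ = (D.Psiᴴ * D.Psi) * (Matrix.diagonal fun p => (D.eig p.1 : ℂ)) *
          (D.Psiᴴ * D.Psi) := by simp only [Matrix.mul_assoc]
      _ = _ := by rw [D.conjTranspose_mul, one_mul, mul_one]
  have hinj : Function.Injective D.Psi.mulVec := by
    intro x y hxy
    have h := congrArg (D.Psiᴴ *ᵥ ·) hxy
    simpa [D.conjTranspose_mul] using h
  have hpd := hA.conjTranspose_mul_mul_same hinj
  rw [hdiag, Matrix.posDef_diagonal_iff] at hpd
  exact_mod_cast hpd ⟨i, ⟨0, D.mult_pos i⟩⟩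

/-- A matrix with a two-sided inverse is square. -/
theorem sum_mult : ∑ i, D.mult i = Fintype.card n := by
  have h := Matrix.square_of_invertible D.Psi D.Psiᴴ D.mul_conjTranspose D.conjTranspose_mul
  rw [Fintype.card_sigma] at h
  simpa using h.symm

/-- The matrix `Λ^{-1/2} Ψᴴ`. -/
noncomputable def whitening : Matrix (Σ i, Fin (D.mult i)) n ℂ :=
  (Matrix.diagonal (fun p => ((Real.sqrt (D.eig p.1))⁻¹ : ℂ)) :
    Matrix (Σ i, Fin (D.mult i)) (Σ i, Fin (D.mult i)) ℂ) * D.Psiᴴ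

theorem whitening_mulVec (x : n → ℂ) (i : Fin D.num) (j : Fin (D.mult i)) :
    (D.whitening *ᵥ x) ⟨i, j⟩ = D.chi x i j := by
  rw [whitening, ← Matrix.mulVec_mulVec, Matrix.mulVec_diagonal, chi]

/-- This supplies the identity-covariance hypothesis of `map_mulVec_pi_complexGaussian`. -/
theorem whitening_mul_mul_conjTranspose (hpos : ∀ i, 0 < D.eig i) :
    D.whitening * A * D.whiteningᴴ = 1 := by
  have h := D.decomposition
  calc D.whitening * A * D.whiteningᴴ = D.whitening * (D.Psi *
          (Matrix.diagonal (fun p => (D.eig p.1 : ℂ)) : Matrix (Σ i, Fin (D.mult i)) _ ℂ) *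
          D.Psiᴴ) * D.whiteningᴴ := by rw [← h]
    _ = (Matrix.diagonal (fun p => ((Real.sqrt (D.eig p.1))⁻¹ : ℂ)) :
          Matrix (Σ i, Fin (D.mult i)) (Σ i, Fin (D.mult i)) ℂ) * ((D.Psiᴴ * D.Psi) *
          (Matrix.diagonal fun p => (D.eig p.1 : ℂ)) * (D.Psiᴴ * D.Psi)) *
          (Matrix.diagonal (fun p => ((Real.sqrt (D.eig p.1))⁻¹ : ℂ)) :
            Matrix (Σ i, Fin (D.mult i)) (Σ i, Fin (D.mult i)) ℂ)ᴴ := by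
        simp only [whitening, Matrix.conjTranspose_mul, Matrix.conjTranspose_conjTranspose,
          Matrix.mul_assoc]
    _ = 1 := by
        rw [D.conjTranspose_mul, one_mul, mul_one, Matrix.diagonal_conjTranspose,
          Matrix.diagonal_mul_diagonal, Matrix.diagonal_mul_diagonal, ← Matrix.diagonal_one]
        congr 1
        ext p
        have hp := hpos p.1
        have hs : (Real.sqrt (D.eig p.1) : ℂ) ≠ 0 := by
          exact_mod_cast (Real.sqrt_pos.2 hp).ne'
        have hsq : (D.eig p.1 : ℂ) = (Real.sqrt (D.eig p.1) : ℂ) ^ 2 := by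
          rw [← Complex.ofReal_pow, Real.sq_sqrt hp.le]
        simp only [Pi.star_apply, star_inv₀, Complex.star_def, Complex.conj_ofReal]
        rw [hsq]
        field_simp

/-- The unitary `Ψᴴ` preserves the norm, and undoing the scaling by `Λ^{-1/2}` brings out the
weights `λ_i`. -/
theorem sum_norm_sq_eq (hpos : ∀ i, 0 < D.eig i) (x : n → ℂ) :
    ∑ p, ‖x p‖ ^ 2 = ∑ q : Σ i, Fin (D.mult i), D.eig q.1 * ‖(D.whitening *ᵥ x) q‖ ^ 2 := by
  have h2 : ∑ p, ‖x p‖ ^ 2 = ∑ q, ‖(D.Psiᴴ *ᵥ x) q‖ ^ 2 := by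
    have : ((∑ p, ‖x p‖ ^ 2 : ℝ) : ℂ) = ((∑ q, ‖(D.Psiᴴ *ᵥ x) q‖ ^ 2 : ℝ) : ℂ) := by
      rw [ofReal_sum_norm_sq, ofReal_sum_norm_sq, Matrix.star_mulVec, Matrix.conjTranspose_conjTranspose, ← Matrix.dotProduct_mulVec,
        Matrix.mulVec_mulVec, D.mul_conjTranspose, Matrix.one_mulVec]
    exact_mod_cast this
  rw [h2]
  refine Finset.sum_congr rfl fun q _ => ?_
  rw [whitening, ← Matrix.mulVec_mulVec, Matrix.mulVec_diagonal, norm_mul, mul_pow, norm_inv,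
    Complex.norm_real, Real.norm_eq_abs, inv_pow, sq_abs, Real.sq_sqrt (hpos _).le,
    mul_inv_cancel_left₀ (hpos _).ne']

/-- The Laplace transform of `∑_{i,j} λ_i |w_{ij} + χ_i^{(j)}|²` for standard complex Gaussian
`w`. -/
noncomputable def laplace (μ : n → ℂ) (z : ℂ) : ℂ :=
  ∏ i, (((1 + z * D.eig i) ^ D.mult i)⁻¹ *
    Complex.exp (-(z * D.eig i / (1 + z * D.eig i) * D.chiSq μ i)))

theorem integral_exp_eq_laplace (hpos : ∀ i, 0 < D.eig i) (μ : n → ℂ) {z : ℂ} (hz : 0 ≤ z.re) :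
    ∫ w : (Σ i, Fin (D.mult i)) → ℂ,
        Complex.exp (-z * (∑ q, D.eig q.1 * ‖w q + (D.whitening *ᵥ μ) q‖ ^ 2 : ℝ))
        ∂(Measure.pi fun _ => complexGaussian 1) = D.laplace μ z := by
  rw [integral_exp_neg_mul_sum_pi_complexGaussian
    (lam := fun q : Σ i, Fin (D.mult i) => D.eig q.1) (fun q => (hpos q.1).le) _ hz,
    Fintype.prod_sigma, laplace]
  refine Finset.prod_congr rfl fun i _ => ?_
  dsimp only
  rw [Finset.prod_mul_distrib, Finset.prod_const, Finset.card_univ, Fintype.card_fin, inv_pow,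
    ← Complex.exp_sum, Finset.sum_neg_distrib, chiSq]
  simp only [whitening_mulVec]
  push_cast
  rw [Finset.mul_sum]
  congr 3
  exact Finset.sum_congr rfl fun j _ => by ring

/-- The singularities of the Laplace transform. -/
noncomputable def pole (i : Fin D.num) : ℂ := -(1 / (D.eig i : ℂ))

theorem pole_injective : Function.Injective D.pole := by
  intro i j h
  simp only [pole, one_div, neg_inj, inv_inj, Complex.ofReal_inj] at h
  exact D.eig_injective h

variable {D}

theorem one_add_mul_eig_ne_zero {i : Fin D.num} (hpos : 0 < D.eig i) {z : ℂ} (hz : z ≠ D.pole i) :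
    1 + z * D.eig i ≠ 0 := by
  intro h
  have h0 : (D.eig i : ℂ) ≠ 0 := by exact_mod_cast hpos.ne'
  apply hz
  rw [pole]
  field_simp
  linear_combination h

theorem differentiableAt_laplace (hpos : ∀ i, 0 < D.eig i) (μ : n → ℂ) {z : ℂ}
    (hz : ∀ i, z ≠ D.pole i) : DifferentiableAt ℂ (D.laplace μ) z := by
  have hne := fun i => one_add_mul_eig_ne_zero (hpos i) (hz i)
  unfold laplace
  refine DifferentiableAt.fun_finsetProd fun i _ => ?_
  have h1 : DifferentiableAt ℂ (fun z : ℂ => 1 + z * (D.eig i : ℂ)) z := by fun_prop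
  exact ((h1.fun_pow _).fun_inv (pow_ne_zero _ (hne i))).mul
    ((((by fun_prop : DifferentiableAt ℂ (fun z : ℂ => z * (D.eig i : ℂ)) z).fun_div h1
      (hne i)).mul_const _).fun_neg.cexp)

-- In each factor `zλ / (1 + zλ) = 1 - (1 + zλ)⁻¹` tends to `1`, so the exponential converges while
-- the positive power of `(1 + zλ)⁻¹` tends to `0`. An eigenvalue is needed: the empty product is
-- `1`.
open Filter Topology in
theorem tendsto_laplace_cocompact (hpos : ∀ i, 0 < D.eig i) (hnum : 0 < D.num) (μ : n → ℂ) :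
    Tendsto (D.laplace μ) (cocompact ℂ) (𝓝 0) := by
  have hfac : ∀ i, Tendsto (fun z : ℂ => ((1 + z * D.eig i) ^ D.mult i)⁻¹ *
      Complex.exp (-(z * D.eig i / (1 + z * D.eig i) * D.chiSq μ i))) (cocompact ℂ) (𝓝 0) := by
    intro i
    have hnorm : Tendsto (fun z : ℂ => ‖1 + z * D.eig i‖) (cocompact ℂ) atTop := by
      refine tendsto_atTop_mono (f := fun z : ℂ => ‖z‖ * D.eig i - 1) (fun z => ?_)
        (tendsto_atTop_add_const_right _ _
          ((tendsto_norm_cocompact_atTop (E := ℂ)).atTop_mul_const (hpos i)))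
      have h := norm_sub_norm_le (z * D.eig i : ℂ) (-1)
      rw [norm_neg, norm_one, norm_mul, Complex.norm_real, Real.norm_of_nonneg (hpos i).le] at h
      rwa [sub_neg_eq_add, add_comm (z * (D.eig i : ℂ))] at h
    have hinv : Tendsto (fun z : ℂ => (1 + z * D.eig i)⁻¹) (cocompact ℂ) (𝓝 0) := by
      rw [tendsto_zero_iff_norm_tendsto_zero]
      simpa [Function.comp_def] using tendsto_inv_atTop_zero.comp hnorm
    have hpow := hinv.pow (D.mult i)
    rw [zero_pow (D.mult_pos i).ne'] at hpow
    have hexp : Tendsto (fun z : ℂ => Complex.exp (-((1 - (1 + z * D.eig i)⁻¹) * D.chiSq μ i)))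
        (cocompact ℂ) (𝓝 (Complex.exp (-((1 - 0) * D.chiSq μ i)))) :=
      (Complex.continuous_exp.tendsto _).comp (((hinv.const_sub 1).mul_const _).neg)
    have h := hpow.mul hexp
    rw [zero_mul] at h
    refine h.congr' ?_
    filter_upwards [hnorm.eventually_gt_atTop 0] with z hz
    have hz' := norm_pos_iff.1 hz
    rw [inv_pow]
    congr 4
    field_simp
    ring
  have h := tendsto_finsetProd (Finset.univ : Finset (Fin D.num)) fun i _ => hfac i
  rwa [Finset.prod_const, zero_pow (by simpa using hnum.ne')] at h

/-- At `s = w - 1/λ_i` one has `1 + s λ_i = λ_i w`, so the exponent of the `i`-th factor splits as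
`-‖χ_i‖² + ‖χ_i‖² / (λ_i w)`. The other factors, with `e^{as} / s`, form `g`. -/
theorem exp_div_mul_laplace_add_pole (hpos : ∀ i, 0 < D.eig i) (μ : n → ℂ) (a : ℝ) (i : Fin D.num)
    {w : ℂ} (hw : w ≠ 0) :
    Complex.exp (a * (w + D.pole i)) / (w + D.pole i) * D.laplace μ (w + D.pole i) =
      Complex.exp (-(a / D.eig i + D.chiSq μ i)) / (D.eig i : ℂ) ^ D.mult i *
        (D.g μ a i w / w ^ D.mult i * Complex.exp ((D.chiSq μ i / D.eig i : ℝ) / w)) := by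
  have h0 : (D.eig i : ℂ) ≠ 0 := by exact_mod_cast (hpos i).ne'
  have hs : w + D.pole i = w - 1 / D.eig i := by rw [pole]; ring
  have hi : 1 + (w - 1 / D.eig i) * D.eig i = D.eig i * w := by field_simp; ring
  rw [hs, laplace, ← Finset.mul_prod_erase _ _ (Finset.mem_univ i), hi, g,
    Finset.prod_mul_distrib, ← Complex.exp_sum, Finset.sum_neg_distrib, Finset.prod_inv_distrib]
  have e1 : Complex.exp (a * (w - 1 / D.eig i)) =
      Complex.exp (a * w) * Complex.exp (-(a / D.eig i)) := by
    rw [← Complex.exp_add]; congr 1; ring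
  have e2 : Complex.exp (-((w - 1 / D.eig i) * D.eig i / (D.eig i * w) * D.chiSq μ i)) =
      Complex.exp (-(D.chiSq μ i : ℂ)) * Complex.exp ((D.chiSq μ i / D.eig i : ℝ) / w) := by
    rw [← Complex.exp_add]; congr 1; push_cast; field_simp; ring
  rw [e1, e2, neg_add, Complex.exp_add, mul_pow, mul_inv]
  ring

/-- The singularities of `g` sit where `s = w - 1/λ_i` is `0` or another pole. The two conditions on
`r` keep the disc away from each kind. -/
theorem differentiableOn_g (hpos : ∀ i, 0 < D.eig i) (μ : n → ℂ) (a : ℝ) (i : Fin D.num) {r : ℝ}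
    (hr : (D.pole i).re + r < 0) (hsep : ∀ p, p ≠ i → r < dist (D.pole p) (D.pole i)) :
    DifferentiableOn ℂ (D.g μ a i) (Metric.closedBall 0 r) := by
  intro w hw
  rw [mem_closedBall_zero_iff] at hw
  have hs : w - 1 / D.eig i = w + D.pole i := by rw [pole]; ring
  have h1 : w - 1 / D.eig i ≠ 0 := by
    intro h
    have h2 := congrArg Complex.re (hs.symm.trans h)
    rw [Complex.add_re, Complex.zero_re] at h2
    linarith [(Complex.re_le_norm w)]
  have h2 : ∀ p ∈ Finset.univ.erase i, 1 + (w - 1 / D.eig i) * D.eig p ≠ 0 := by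
    intro p hp
    refine one_add_mul_eig_ne_zero (hpos p) fun h => ?_
    have h3 := hsep p (Finset.ne_of_mem_erase hp)
    rw [← h, hs, dist_eq_norm, add_sub_cancel_right] at h3
    linarith
  unfold g
  refine DifferentiableAt.differentiableWithinAt ?_
  have d1 : ∀ p, DifferentiableAt ℂ (fun s : ℂ => 1 + (s - 1 / D.eig i) * D.eig p) w := by
    intro p; fun_prop
  refine ((by fun_prop : DifferentiableAt ℂ (fun s : ℂ => Complex.exp (a * s)) w).fun_div
    (by fun_prop) h1).mul (DifferentiableAt.fun_div (DifferentiableAt.cexp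
      (DifferentiableAt.fun_neg (DifferentiableAt.fun_sum fun p hp => ?_)))
      (DifferentiableAt.fun_finsetProd fun p _ => (d1 p).fun_pow _)
      (Finset.prod_ne_zero_iff.2 fun p hp => pow_ne_zero _ (h2 p hp)))
  exact (DifferentiableAt.fun_div (by fun_prop) (d1 p) (h2 p hp)).mul_const _

theorem hasSum_seriesTerm (hpos : ∀ i, 0 < D.eig i) (μ : n → ℂ) (a : ℝ) (i : Fin D.num) {r : ℝ}
    (hr0 : 0 < r) (hr : (D.pole i).re + r < 0)
    (hsep : ∀ p, p ≠ i → r < dist (D.pole p) (D.pole i)) :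
    HasSum (fun l : Set.Ici (D.mult i - 1) => D.seriesTerm μ a i l)
      ((2 * Real.pi * Complex.I)⁻¹ * ∮ w in C(0, r),
        D.g μ a i w / w ^ D.mult i * Complex.exp ((D.chiSq μ i / D.eig i : ℝ) / w)) := by
  have hm : D.mult i - 1 + 1 = D.mult i := Nat.sub_add_cancel (D.mult_pos i)
  -- The series starts at `mult i - 1`, the order `q` of the residue lemma. Since `mult i > 0`, the
  -- truncated subtractions are exact.
  let e : ℕ ≃ Set.Ici (D.mult i - 1) :=
    { toFun := fun l => ⟨l + (D.mult i - 1), by simp⟩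
      invFun := fun l => l.1 - (D.mult i - 1)
      left_inv := fun l => by simp
      right_inv := fun l => Subtype.ext (Nat.sub_add_cancel l.2) }
  rw [← e.hasSum_iff]
  have h := hasSum_residue_mul_exp_div hr0 (differentiableOn_g hpos μ a i hr hsep) (D.mult i - 1)
    ((D.chiSq μ i / D.eig i : ℝ) : ℂ)
  rw [hm] at h
  convert h using 2 with l
  have h1 : l + (D.mult i - 1) + 1 - D.mult i = l := by omega
  simp only [Function.comp_apply, e, Equiv.coe_fn_mk, seriesTerm, h1]

open Filter Topology in
theorem exists_radius (hpos : ∀ i, 0 < D.eig i) : ∃ r > 0, (∀ i, (D.pole i).re + r < 0) ∧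
    ∀ i j, i ≠ j → 2 * r < dist (D.pole i) (D.pole j) := by
  have h1 : ∀ i, ∀ᶠ r in 𝓝[>] (0 : ℝ), (D.pole i).re + r < 0 := fun i => by
    have hre : (D.pole i).re < 0 := by
      have : D.pole i = ((-(1 / D.eig i) : ℝ) : ℂ) := by rw [pole]; push_cast; rfl
      rw [this, Complex.ofReal_re]
      have := hpos i
      simp only [Left.neg_neg_iff]; positivity
    have hc : Tendsto (fun r : ℝ => (D.pole i).re + r) (𝓝[>] 0) (𝓝 ((D.pole i).re + 0)) :=
      (tendsto_const_nhds.add tendsto_id).mono_left nhdsWithin_le_nhds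
    exact hc.eventually (gt_mem_nhds (by simpa using hre))
  have h2 : ∀ i j, i ≠ j → ∀ᶠ r in 𝓝[>] (0 : ℝ), 2 * r < dist (D.pole i) (D.pole j) := by
    intro i j hij
    have hd : 0 < dist (D.pole i) (D.pole j) := dist_pos.2 (D.pole_injective.ne hij)
    have hc : Tendsto (fun r : ℝ => 2 * r) (𝓝[>] 0) (𝓝 (2 * 0)) :=
      (tendsto_id.const_mul 2).mono_left nhdsWithin_le_nhds
    exact hc.eventually (gt_mem_nhds (by simpa using hd))
  have h3 : ∀ᶠ r in 𝓝[>] (0 : ℝ), 0 < r := self_mem_nhdsWithin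
  obtain ⟨r, hr, hr1, hr2⟩ := (h3.and ((eventually_all.2 h1).and
    (eventually_all.2 fun i => eventually_all.2 fun j => eventually_imp_distrib_left.2 (h2 i j)))).exists
  exact ⟨r, hr, hr1, hr2⟩

/-- Tail probabilities of a law with Laplace transform `D.laplace μ`. -/
theorem measureReal_Ici_eq {ν : Measure ℝ} [IsFiniteMeasure ν] (hpos : ∀ i, 0 < D.eig i)
    (hnum : 0 < D.num) (μ : n → ℂ)
    (hc : ∀ t : ℝ, charFun ν t = D.laplace μ (-(t * Complex.I))) {a : ℝ} (ha : 0 ≤ a) :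
    (ν.real (Set.Ici a) : ℂ) = -∑ i, Complex.exp (-(a / D.eig i + D.chiSq μ i)) /
      (D.eig i : ℂ) ^ D.mult i * ∑' l : Set.Ici (D.mult i - 1), D.seriesTerm μ a i l := by
  obtain ⟨r, hr0, hre, hsep⟩ := exists_radius hpos
  rw [measureReal_Ici_eq_neg_sum_circleIntegral (Finset.univ.image D.pole) hr0
    (fun s hs => differentiableAt_laplace hpos μ fun i h => hs (by simp [h]))
    (tendsto_laplace_cocompact hpos hnum μ) ?_ (by simpa using hre) hc ha,
    Finset.sum_image D.pole_injective.injOn]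
  · congr 1
    refine Finset.sum_congr rfl fun i _ => ?_
    rw [(hasSum_seriesTerm hpos μ a i hr0 (hre i)
      fun p hp => by linarith [hsep p i hp]).tsum_eq, circleIntegral_comp_add_center,
      mul_left_comm, ← circleIntegral.integral_const_mul
        (Complex.exp (-(a / D.eig i + D.chiSq μ i)) / (D.eig i : ℂ) ^ D.mult i)]
    refine congrArg _ (circleIntegral.integral_congr hr0.le fun w hw => ?_)
    exact exp_div_mul_laplace_add_pole hpos μ a i (by rintro rfl; simp at hw; linarith)
  · simp only [Finset.mem_image, Finset.mem_univ, true_and]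
    rintro _ ⟨i, rfl⟩ _ ⟨j, rfl⟩ hij
    exact hsep i j fun h => hij (by rw [h])

end EigenDecomposition

/-! ### Reduction of the outage event to a quadratic form. -/

namespace MIMOSystem

variable {K d Nt Nr : ℕ} (S : MIMOSystem K d Nt Nr) {Ω : Type*}

theorem gain_add (k : Fin K) (m : Fin d) (i : Fin K) (j : Fin d)
    (A B : Matrix (Fin Nr) (Fin Nt) ℂ) :
    S.gain k m i j (A + B) = S.gain k m i j A + S.gain k m i j B := by
  simp only [gain, Matrix.mul_add, Matrix.add_mul, Matrix.add_apply]

theorem gain_zero (k : Fin K) (m : Fin d) (i : Fin K) (j : Fin d) : S.gain k m i j 0 = 0 := by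
  simp [gain]

/-- The coefficients of the effective gains in the entries of the white matrices. -/
noncomputable def gainMatrix (k : Fin K) (m : Fin d) (Υ : Finset (Fin K)) :
    Matrix ({i // i ∉ Υ} × Fin d) ({i // i ∉ Υ} × Fin Nr × Fin Nt) ℂ :=
  Matrix.of fun p e => if p.1 = e.1 then
    ((S.U k)ᴴ * CFC.sqrt S.Sigma_r) m e.2.1 * (CFC.sqrt S.Sigma_t * S.V p.1) e.2.2 p.2 else 0

theorem interference_eq {k : Fin K} (m : Fin d) {Υ : Finset (Fin K)} (hk : k ∈ Υ)
    (Hw : Fin K → Ω → Matrix (Fin Nr) (Fin Nt) ℂ) (ω : Ω) :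
    S.interference k m Υ Hw ω = (fun p => S.gain k m p.1 p.2 (S.Hhat k p.1)) +
      S.gainMatrix k m Υ *ᵥ fun e => Hw e.1 ω e.2.1 e.2.2 := by
  ext ⟨i, j⟩
  -- The special branch in `interference` is void, since `k ∈ Υ`.
  have hik : i.1 ≠ k := fun h => i.2 (h ▸ hk)
  rw [interference, if_neg (fun h => hik h.1), gain_add, Pi.add_apply]
  congr 1
  rw [csiError, if_neg i.2]
  simp only [gain, gainMatrix, Matrix.mulVec, dotProduct, Matrix.of_apply, Fintype.sum_prod_type,
    ite_mul, zero_mul]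
  rw [Finset.sum_eq_single i (fun x _ hx => by simp [Ne.symm hx]) (by simp)]
  have e : (S.U k)ᴴ * (CFC.sqrt S.Sigma_r * Hw i ω * CFC.sqrt S.Sigma_t) * S.V i =
      (S.U k)ᴴ * CFC.sqrt S.Sigma_r * Hw i ω * (CFC.sqrt S.Sigma_t * S.V i) := by
    simp only [Matrix.mul_assoc]
  have e' : ∀ y, ((S.U k)ᴴ * CFC.sqrt S.Sigma_r * Hw i ω) m y =
      ∑ x, ((S.U k)ᴴ * CFC.sqrt S.Sigma_r) m x * Hw i ω x y := fun _ => Matrix.mul_apply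
  rw [e, Matrix.mul_apply]
  simp only [e', Finset.sum_mul, if_true]
  rw [Finset.sum_comm]
  exact Finset.sum_congr rfl fun _ _ => Finset.sum_congr rfl fun _ _ => by ring

/-- Outage occurs exactly when the interference power over the imperfectly known links reaches the
threshold. -/
theorem outage_eq {k : Fin K} (m : Fin d) {R : ℝ} (hR : 0 < R) {Υ : Finset (Fin K)} (hk : k ∈ Υ)
    (Hw : Fin K → Ω → Matrix (Fin Nr) (Fin Nt) ℂ) :
    S.outage k m R Υ Hw =
      {ω | S.threshold k m R Υ ≤ ∑ p, ‖S.interference k m Υ Hw ω p‖ ^ 2} := by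
  ext ω
  simp only [outage, Set.mem_ofPred_eq, sinr, threshold]
  set a := ‖S.gain k m k m (S.Hhat k k)‖ ^ 2 with ha
  have hc : 0 < (2 : ℝ) ^ R - 1 := sub_pos.2 (Real.one_lt_rpow one_lt_two hR)
  set E : Fin K → Matrix (Fin Nr) (Fin Nt) ℂ := fun i => S.csiError Υ Hw i ω with hE
  have hE0 : ∀ i ∈ Υ, E i = 0 := fun i hi => by simp [hE, csiError, hi]
  have hX : ∑ p, ‖S.interference k m Υ Hw ω p‖ ^ 2 =
      ∑ i ∈ Finset.univ \ Υ, ∑ j, ‖S.gain k m i j (S.Hhat k i + E i)‖ ^ 2 := by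
    rw [Fintype.sum_prod_type, Finset.sum_subtype (p := fun i => i ∉ Υ) _ (fun i => by simp)]
    refine Finset.sum_congr rfl fun i _ => Finset.sum_congr rfl fun j _ => ?_
    have hik : i.1 ≠ k := fun h => i.2 (h ▸ hk)
    rw [interference, if_neg fun h => hik h.1]
  have hsplit : Finset.univ.erase k = Υ.erase k ∪ (Finset.univ \ Υ) := by
    ext i
    simp only [Finset.mem_erase, Finset.mem_univ, and_true, Finset.mem_union, Finset.mem_sdiff,
      true_and]
    constructor
    · intro h; by_cases hi : i ∈ Υ <;> simp [h, hi]
    · rintro (h | h)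
      · exact h.1
      · rintro rfl; exact h hk
  have hdisj : Disjoint (Υ.erase k) (Finset.univ \ Υ) :=
    Finset.disjoint_left.2 fun i h1 h2 => (Finset.mem_sdiff.1 h2).2 (Finset.mem_of_mem_erase h1)
  -- The errors vanish on `Υ`, in particular in the self-interference term. Stream `m` is split off
  -- on the known links other than `k`, to match the two sums in the threshold.
  have hden : ‖S.gain k m k m (E k)‖ ^ 2
      + ∑ j ∈ Finset.univ.erase m, ‖S.gain k m k j (S.Hhat k k + E k)‖ ^ 2
      + ∑ i ∈ Finset.univ.erase k, ∑ j, ‖S.gain k m i j (S.Hhat k i + E i)‖ ^ 2 + S.noise =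
      ∑ i ∈ Υ, ∑ j ∈ Finset.univ.erase m, ‖S.gain k m i j (S.Hhat k i)‖ ^ 2
      + ∑ i ∈ Υ.erase k, ‖S.gain k m i m (S.Hhat k i)‖ ^ 2 + S.noise
      + ∑ p, ‖S.interference k m Υ Hw ω p‖ ^ 2 := by
    have h1 : ∑ i ∈ Υ.erase k, ∑ j, ‖S.gain k m i j (S.Hhat k i + E i)‖ ^ 2 =
        ∑ i ∈ Υ.erase k, (‖S.gain k m i m (S.Hhat k i)‖ ^ 2 +
          ∑ j ∈ Finset.univ.erase m, ‖S.gain k m i j (S.Hhat k i)‖ ^ 2) :=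
      Finset.sum_congr rfl fun i hi => by
        rw [hE0 i (Finset.mem_of_mem_erase hi), add_zero, Finset.add_sum_erase _ (fun j => ‖S.gain k m i j (S.Hhat k i)‖ ^ 2)
          (Finset.mem_univ m)]
    rw [hX, hsplit, Finset.sum_union hdisj, h1, Finset.sum_add_distrib, hE0 k hk, gain_zero,
      add_zero, ← Finset.add_sum_erase Υ
        (fun i => ∑ j ∈ Finset.univ.erase m, ‖S.gain k m i j (S.Hhat k i)‖ ^ 2) hk]
    simp only [norm_zero]
    ring
  rw [hden]
  set D := ∑ i ∈ Υ, ∑ j ∈ Finset.univ.erase m, ‖S.gain k m i j (S.Hhat k i)‖ ^ 2 with hD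
  set D' := ∑ i ∈ Υ.erase k, ‖S.gain k m i m (S.Hhat k i)‖ ^ 2 with hD'
  set Y := ∑ p, ‖S.interference k m Υ Hw ω p‖ ^ 2 with hY
  have hD0 : 0 ≤ D := Finset.sum_nonneg fun _ _ => Finset.sum_nonneg fun _ _ => sq_nonneg _
  have hD0' : 0 ≤ D' := Finset.sum_nonneg fun _ _ => sq_nonneg _
  have hY0 : 0 ≤ Y := Finset.sum_nonneg fun _ _ => sq_nonneg _
  have hpos : 0 < D + D' + S.noise + Y := by linarith [S.noise_pos]
  have ha0 : 0 ≤ a := sq_nonneg _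
  rw [Real.logb_le_iff_le_rpow one_lt_two
    (add_pos_of_pos_of_nonneg one_pos (div_nonneg ha0 hpos.le)), ← le_sub_iff_add_le', div_le_iff₀ hpos,
    mul_comm, ← div_le_iff₀ hc]
  constructor <;> intro h <;> linarith

end MIMOSystem

/-! ### The outage probability. -/

theorem corollary1 {K d Nt Nr : ℕ} (S : MIMOSystem K d Nt Nr)
    (k : Fin K) (m : Fin d) (R : ℝ) (hR : 0 < R)
    (Υ : Finset (Fin K)) (hk : k ∈ Υ)
    {Ω : Type*} [MeasurableSpace Ω] (P : Measure Ω) [IsProbabilityMeasure P]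
    (Hw : Fin K → Ω → Matrix (Fin Nr) (Fin Nt) ℂ)
    (hHw : HasLaw (fun ω (p : {i // i ∉ Υ} × Fin Nr × Fin Nt) => Hw p.1 ω p.2.1 p.2.2)
      (Measure.pi fun _ => complexGaussian S.sigma_h_sq) P)
    (hpd : (covMat P (S.interference k m Υ Hw)).PosDef)
    (D : EigenDecomposition (covMat P (S.interference k m Υ Hw))) :
    ∑ i, D.mult i = (K - Υ.card) * d ∧
    (0 < S.threshold k m R Υ ∨ (S.threshold k m R Υ = 0 ∧ Υ ≠ Finset.univ) →
      (∀ i, Summable fun l : Set.Ici (D.mult i - 1) =>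
        D.seriesTerm (meanVec P (S.interference k m Υ Hw)) (S.threshold k m R Υ) i l) ∧
      (P.real (S.outage k m R Υ Hw) : ℂ) =
        -∑ i, Complex.exp (-(S.threshold k m R Υ / D.eig i +
              D.chiSq (meanVec P (S.interference k m Υ Hw)) i)) / (D.eig i : ℂ) ^ D.mult i *
            ∑' l : Set.Ici (D.mult i - 1),
              D.seriesTerm (meanVec P (S.interference k m Υ Hw)) (S.threshold k m R Υ) i l) ∧
    (S.threshold k m R Υ ≤ 0 → P.real (S.outage k m R Υ Hw) = 1) := by
  have hpos := D.eig_pos hpd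
  have hcard : ∑ i, D.mult i = (K - Υ.card) * d := by
    rw [D.sum_mult, Fintype.card_prod, Fintype.card_fin, Fintype.card_subtype_compl]
    simp
  refine ⟨hcard, fun hτ => ⟨fun i => ?_, ?_⟩, fun hτ => ?_⟩
  · obtain ⟨r, hr0, hre, hsep⟩ := EigenDecomposition.exists_radius hpos
    exact (EigenDecomposition.hasSum_seriesTerm hpos _ _ i hr0 (hre i)
      fun p hp => by linarith [hsep p i hp]).summable
  · rw [S.outage_eq m hR hk Hw]
    set τ := S.threshold k m R Υ with hτdef
    set μ := meanVec P (S.interference k m Υ Hw) with hμ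
    have hτ0 : 0 ≤ τ := hτ.elim le_of_lt fun h => h.1.ge
    -- Without eigenvalues every link is known, so the hypothesis forces `τ > 0`: the interference
    -- is `0 < τ` and both sides vanish. At `τ = 0` the left side would be `1`, hence the exclusion
    -- in the statement.
    by_cases hnum : D.num = 0
    · have hΥ : Υ = Finset.univ := by
        by_contra hne
        have hlt : Υ.card < K := by
          simpa using (Finset.card_lt_iff_ne_univ Υ).2 hne
        have h0 : ∑ i, D.mult i = 0 := Finset.sum_eq_zero fun i _ => by
          have := i.2; omega
        rw [h0] at hcard
        have : 0 < (K - Υ.card) * d := Nat.mul_pos (by omega) m.pos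
        omega
      have hτ' : 0 < τ := hτ.resolve_right fun h => h.2 hΥ
      have hn : IsEmpty ({i // i ∉ Υ} × Fin d) := ⟨fun p => p.1.2 (by simp [hΥ])⟩
      have he : IsEmpty (Fin D.num) := by rw [hnum]; infer_instance
      simp [hτ'.not_ge]
    set h : Ω → ({i // i ∉ Υ} × Fin Nr × Fin Nt) → ℂ := fun ω p => Hw p.1 ω p.2.1 p.2.2 with hh
    set b : {i // i ∉ Υ} × Fin d → ℂ := fun p => S.gain k m p.1 p.2 (S.Hhat k p.1) with hb
    set A := S.gainMatrix k m Υ with hA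
    have hX : ∀ ω, S.interference k m Υ Hw ω = b + A *ᵥ h ω := S.interference_eq m hk Hw
    have hAc : Continuous fun x => A *ᵥ x := (LinearMap.toContinuousLinearMap A.mulVecLin).continuous
    have hμb : μ = b := by
      ext p
      have hi := hHw.integral_comp (f := fun x => b p + (A *ᵥ x) p)
        (continuous_const.add ((continuous_apply p).comp hAc)).aestronglyMeasurable
      rw [integral_add (integrable_const _) (integrable_mulVec_pi_complexGaussian _ A p),
        integral_mulVec_pi_complexGaussian, integral_const] at hi
      simp only [hμ, meanVec, hX]
      simpa using hi
    have hcov : covMat P (S.interference k m Υ Hw) = (S.sigma_h_sq : ℂ) • (A * Aᴴ) := by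
      ext p q
      have hi := hHw.integral_comp (f := fun x => (A *ᵥ x) p * star ((A *ᵥ x) q))
        (((continuous_apply p).comp hAc).mul
          ((continuous_apply q).comp hAc).star).aestronglyMeasurable
      rw [integral_mulVec_mul_star_pi_complexGaussian] at hi
      simp only [covMat, Matrix.of_apply, ← hμ, hμb, hX, Pi.add_apply, add_sub_cancel_left]
      exact hi
    have hC : (S.sigma_h_sq : ℂ) • ((D.whitening * A) * (D.whitening * A)ᴴ) = 1 := by
      have hw := D.whitening_mul_mul_conjTranspose hpos
      -- The type of `D` depends on the covariance matrix, so the matrix is generalized before its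
      -- value is substituted.
      generalize covMat P (S.interference k m Υ Hw) = Cov at hcov D hw ⊢
      subst hcov
      rw [← hw, Matrix.conjTranspose_mul]
      simp only [Matrix.mul_assoc, Matrix.mul_smul, Matrix.smul_mul]
    have hYm : AEMeasurable (fun ω => ∑ p, ‖S.interference k m Υ Hw ω p‖ ^ 2) P := by
      simp only [hX]
      exact (by fun_prop : Continuous fun x : ({i // i ∉ Υ} × Fin Nr × Fin Nt) → ℂ =>
        ∑ p, ‖(b + A *ᵥ x) p‖ ^ 2).measurable.comp_aemeasurable hHw.aemeasurable
    have := Measure.isProbabilityMeasure_map hYm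
    rw [← EigenDecomposition.measureReal_Ici_eq
      (ν := P.map fun ω => ∑ p, ‖S.interference k m Υ Hw ω p‖ ^ 2) hpos (Nat.pos_of_ne_zero hnum)
      μ (fun t => ?_) hτ0, measureReal_def, measureReal_def,
      Measure.map_apply_of_aemeasurable hYm measurableSet_Ici]
    · rfl
    -- The characteristic function at `t` is the Laplace transform at `z = -it`, where `z.re = 0`.
    -- Both sides become integrals over the law of the white entries, with equal integrands once the
    -- power is whitened.
    · rw [← D.integral_exp_eq_laplace hpos μ (by simp), ← map_mulVec_pi_complexGaussian _ _ hC,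
        integral_map (by fun_prop) (Continuous.aestronglyMeasurable (by fun_prop)), charFun_apply_real,
        integral_map hYm (by fun_prop), ← hHw.integral_comp (Continuous.aestronglyMeasurable (by fun_prop))]
      refine integral_congr_ae (Filter.Eventually.of_forall fun ω => ?_)
      simp only [Function.comp_apply]
      rw [D.sum_norm_sq_eq hpos, hX, hμb]
      have e : ∀ q, (D.whitening *ᵥ (b + A *ᵥ h ω)) q =
          ((D.whitening * A) *ᵥ h ω) q + (D.whitening *ᵥ b) q := fun q => by
        rw [Matrix.mulVec_add, Matrix.mulVec_mulVec, Pi.add_apply, add_comm]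
      simp only [e]
      congr 1
      ring
  · have hall : S.outage k m R Υ Hw = Set.univ := by
      rw [S.outage_eq m hR hk Hw, Set.eq_univ_iff_forall]
      exact fun ω => hτ.trans (by positivity)
    rw [hall, probReal_univ]
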